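/- Let $d,n\ge 1$. Cubes $Q\subset\mathbb R^d$ have sides parallel to the axes. A countable collection $\mathcal S$ of cubes is $\frac12$-sparse if there are pairwise disjoint measurable sets $E_Q\subset Q$ ($Q\in\mathcal S$) with $|E_Q|\ge \frac12|Q|$. For scalar $h$ put $\langle h\rangle_{p,Q}=|Q|^{-1/p}\|h\mathbf 1_Q\|_p$, and for $1\le p<\infty$ and $F\in L^p_{\mathrm{loc}}(\mathbb R^d;\mathbb R^n)$ let $\langle F\rangle_{p,Q}=\{\frac1{|Q|}\int_Q F\varphi\,dx:\ \varphi:Q\to\mathbb R,\ \langle\varphi\rangle_{p',Q}\le 1\}\subset\mathbb R^n$, a symmetric convex body; here $p'$ is the Hölder conjugate of $p$. For symmetric convex bodies $A,B\subset\mathbb R^n$ the product $AB$ denotes the number $\sup\{\langle a,b\rangle: a\in A,\,b\in B\}$. Let $W,V$ be matrix weights, i.e. locally integrable functions on $\mathbb R^d$ with values in the symmetric positive semidefinite real $n\times n$ matrices, write $W_Q=\frac1{|Q|}\int_QW$, and set $$[W,V]_{A_2}=\sup_Q\big\|W_Q^{1/2}V_Q^{1/2}\big\|^2,\qquad [W]_{A_\infty}=\sup_{|\xi|=1}\,[\langle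 W\xi,\xi\rangle]_{A_\infty},\qquad [w]_{A_\infty}=\sup_Q\frac1{w(Q)}\int_Q M(w\mathbf 1_Q)\,dx,$$ where $M h(x)=\sup_{Q\ni x}\langle h\rangle_{1,Q}$, $w(Q)=\int_Qw$, and cubes with $w(Q)=0$ are disregarded. Then there is a constant $C$ depending only on $d$ and $n$ such that for all matrix weights $W,V$ with $[W]_{A_\infty},[V]_{A_\infty}<\infty$, all $f,g$ of unit norm in $L^2(\mathbb R^d;\mathbb R^n)$ and all $\frac12$-sparse collections $\mathcal S$, $$\inf_{\varepsilon>0}\ \frac1\varepsilon\sum_{Q\in\mathcal S}|Q|\,\langle V^{1/2}f\rangle_{1+\varepsilon,Q}\,\langle W^{1/2}g\rangle_{1+\varepsilon,Q}\ \le\ C\,\max\{[W]_{A_\infty},[V]_{A_\infty}\}\,\sqrt{[W,V]_{A_2}\,[W]_{A_\infty}\,[V]_{A_\infty}},$$ where the infimum is over those $\varepsilon>0$ for which $V^{1/2}f$ and $W^{1/2}g$ belong to $L^{1+\varepsilon}_{\mathrm{loc}}(\mathbb R^d;\mathbb R^n)$, so that the averages are defined (in particular such $\varepsilon$ exist). 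-/

import Mathlib

open MeasureTheory
open scoped ENNReal NNReal

noncomputable section

namespace MatrixSparse

/-- An axis-parallel cube of `ℝ^d`, given by its lower corner and its side length. -/
structure Cube (d : ℕ) where
  corner : Fin d → ℝ
  side : ℝ
  side_pos : 0 < side

/-- The (half-open) point set of a cube. -/
def Cube.toSet {d : ℕ} (Q : Cube d) : Set (Fin d → ℝ) :=
  {x | ∀ i, Q.corner i ≤ x i ∧ x i < Q.corner i + Q.side}

/-- The Lebesgue measure `|Q|` of a cube. -/
def Cube.vol {d : ℕ} (Q : Cube d) : ℝ≥0∞ := volume Q.toSet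

/-- An `η`-sparse collection of cubes.  (`NullMeasurableSet` is Lebesgue measurability.) -/
def IsSparse {d : ℕ} (η : ℝ) (S : Set (Cube d)) : Prop :=
  S.Countable ∧ ∃ E : Cube d → Set (Fin d → ℝ),
    (∀ Q ∈ S, NullMeasurableSet (E Q) volume ∧ E Q ⊆ Q.toSet ∧
      ENNReal.ofReal η * Q.vol ≤ volume (E Q)) ∧
    ∀ Q ∈ S, ∀ R ∈ S, Q ≠ R → E Q ∩ E R = ∅

/-- The normalized norm `⟨h⟩_{p,Q} = ‖h 1_Q‖_p / |Q|^{1/p}`, for `0 < p ≤ ∞`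
(for `p = ∞` the exponent `1 / p.toReal` is `0`). -/
def normAvg {d : ℕ} (p : ℝ≥0∞) (Q : Cube d) (h : (Fin d → ℝ) → ℝ) : ℝ≥0∞ :=
  eLpNorm (Q.toSet.indicator h) p volume / Q.vol ^ (1 / p.toReal)

/-- The Hardy-Littlewood maximal function `M h (x) = sup_{Q ∋ x} ⟨h⟩_{1,Q}`. -/
def maximalFn {d : ℕ} (h : (Fin d → ℝ) → ℝ) (x : Fin d → ℝ) : ℝ≥0∞ :=
  ⨆ (Q : Cube d) (_ : x ∈ Q.toSet), normAvg 1 Q h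

/-- The (Fujii-Wilson) `A_∞` constant `sup_Q w(Q)⁻¹ ∫_Q M(w 1_Q)` of a scalar weight.
Cubes with `w(Q) = 0` contribute `0 / 0 = 0`. -/
def ainfConst {d : ℕ} (w : (Fin d → ℝ) → ℝ) : ℝ≥0∞ :=
  ⨆ Q : Cube d, (∫⁻ x in Q.toSet, maximalFn (Q.toSet.indicator w) x) /
    ∫⁻ x in Q.toSet, ENNReal.ofReal (w x)

/-- A matrix weight: a locally integrable function on `ℝ^d` whose values are (almost everywhere)
real symmetric positive semidefinite `n × n` matrices. -/
structure IsMatrixWeight {d n : ℕ} (W : (Fin d → ℝ) → Matrix (Fin n) (Fin n) ℝ) : Prop where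
  posSemidef : ∀ᵐ x ∂(volume : Measure (Fin d → ℝ)), (W x).PosSemidef
  locallyIntegrable : ∀ i j, LocallyIntegrable (fun x => W x i j) volume

open scoped MatrixOrder in
/-- The positive semidefinite square root of a positive semidefinite matrix. -/
def matSqrt {n : ℕ} (A : Matrix (Fin n) (Fin n) ℝ) : Matrix (Fin n) (Fin n) ℝ := CFC.sqrt A

/-- The average `W_Q = |Q|⁻¹ ∫_Q W`. -/
def matAvg {d n : ℕ} (W : (Fin d → ℝ) → Matrix (Fin n) (Fin n) ℝ) (Q : Cube d) :
    Matrix (Fin n) (Fin n) ℝ :=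
  Matrix.of fun i j => ⨍ x in Q.toSet, W x i j

/-- The joint matrix `A_2` constant `[W,V]_{A_2} = sup_Q ‖√W_Q √V_Q‖²` (Euclidean operator norm). -/
def matA2Const {d n : ℕ} (W V : (Fin d → ℝ) → Matrix (Fin n) (Fin n) ℝ) : ℝ≥0∞ :=
  ⨆ Q : Cube d,
    ‖Matrix.toEuclideanCLM (𝕜 := ℝ) (matSqrt (matAvg W Q) * matSqrt (matAvg V Q))‖ₑ ^ 2

/-- The directional matrix `A_∞` constant `[W]_{A_∞} = sup_{|ξ| = 1} [⟨W ξ, ξ⟩]_{A_∞}`. -/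
def matAinfConst {d n : ℕ} (W : (Fin d → ℝ) → Matrix (Fin n) (Fin n) ℝ) : ℝ≥0∞ :=
  ⨆ (ξ : EuclideanSpace ℝ (Fin n)) (_ : ‖ξ‖ = 1),
    ainfConst fun x => inner ℝ (Matrix.toEuclideanCLM (𝕜 := ℝ) (W x) ξ) ξ

/-- The function `W^{1/2} f`. -/
def sqrtMul {d n : ℕ} (W : (Fin d → ℝ) → Matrix (Fin n) (Fin n) ℝ)
    (f : (Fin d → ℝ) → EuclideanSpace ℝ (Fin n)) (x : Fin d → ℝ) : EuclideanSpace ℝ (Fin n) :=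
  Matrix.toEuclideanCLM (𝕜 := ℝ) (matSqrt (W x)) (f x)

/-- `F ∈ L^p_loc(ℝ^d; ℝ^n)`. -/
def MemLpLoc {d n : ℕ} (F : (Fin d → ℝ) → EuclideanSpace ℝ (Fin n)) (p : ℝ≥0∞) : Prop :=
  ∀ K : Set (Fin d → ℝ), IsCompact K → MemLp F p (volume.restrict K)

/-- The convex body average `⟨F⟩_{p,Q} = { |Q|⁻¹ ∫_Q F φ : ⟨φ⟩_{p',Q} ≤ 1 } ⊆ ℝ^n` of a function
`F ∈ L^p_loc(ℝ^d; ℝ^n)`, with `p'` the Hölder conjugate exponent of `1 ≤ p < ∞`. -/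
def convexBody {d n : ℕ} (p : ℝ≥0∞) (Q : Cube d) (F : (Fin d → ℝ) → EuclideanSpace ℝ (Fin n)) :
    Set (EuclideanSpace ℝ (Fin n)) :=
  {ξ | ∃ φ : (Fin d → ℝ) → ℝ, AEStronglyMeasurable φ (volume.restrict Q.toSet) ∧
    normAvg (ENNReal.conjExponent p) Q φ ≤ 1 ∧ ξ = ⨍ x in Q.toSet, φ x • F x}

/-- The right endpoint of the symmetric interval `A B = {⟨a, b⟩ : a ∈ A, b ∈ B}`, for symmetric
convex sets `A, B ⊆ ℝ^n`. -/
def bodyProd {n : ℕ} (A B : Set (EuclideanSpace ℝ (Fin n))) : ℝ≥0∞ :=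
  ⨆ (a ∈ A) (b ∈ B), ENNReal.ofReal (inner ℝ a b)

/-- The sparse form `∑_{Q ∈ S} |Q| ⟨F⟩_{p,Q} ⟨G⟩_{p,Q}`. -/
def sparseForm {d n : ℕ} (p : ℝ≥0∞) (S : Set (Cube d))
    (F G : (Fin d → ℝ) → EuclideanSpace ℝ (Fin n)) : ℝ≥0∞ :=
  ∑' Q : S, (Q : Cube d).vol * bodyProd (convexBody p (Q : Cube d) F) (convexBody p (Q : Cube d) G)

end MatrixSparse

end

/-! Everything is reduced to the scalar weights ⟨Wξ,ξ⟩ with |ξ| = 1, whose A_∞ constants are at most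
A = [W]_{A_∞}. Such a weight satisfies a reverse Hölder inequality with exponent 1 + δ, where δ is
comparable to 1/A (`reverse_holder`). A vector a in the convex body of W^{1/2}g has components ⟨a,ξ⟩
equal to the average of φ⟨g, W^{1/2}ξ⟩. Hölder with three factors, φ in L^{(1+ε)/ε}, |W^{1/2}ξ| in
L^{2(1+δ)} and g in L^s, bounds them by 2|W_Q^{1/2}ξ|⟨|g|⟩_{s,Q}
(`IsMatrixWeight.enorm_inner_convexBody_le`). If ε ≤ δ/6, the exponent left for g is s = 2/q with q
- 1 ≥ δ/6: the integrability gained from the weight leaves room below 2.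

Expanding ⟨a,b⟩ in eigenbases of V_Q^{1/2} and W_Q^{1/2} (`enorm_inner_le_of_enorm_inner_le`) turns
these componentwise bounds into the factor [W,V]_{A_2}^{1/2}, at the cost of n². What remains is a
sparse sum of scalar L^s averages. Cauchy-Schwarz and the Carleson embedding theorem in L^q
(`IsSparse.tsum_le`), whose constant is comparable to 1/(q-1), give the factors [V]_{A_∞}^{1/2} and
[W]_{A_∞}^{1/2}. One ε comparable to 1/max{[W]_{A_∞},[V]_{A_∞}} serves both functions, and 1/ε is
the remaining factor.

For the reverse Hölder inequality, let M be the dyadic maximal function of w in Q. For t ≥ w_Q, both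
the w-mass and the M-mass of {M > t} are at most a constant times t|{M > t}|. Integration in t
bounds the integral of M^{1+δ} by itself with a factor 1/2, which is absorbed, and then that of M^δ
w, which dominates w^{1+δ}. -/

noncomputable section

namespace MatrixSparse

variable {d n : ℕ}

/-! ### Cubes, their dyadic children, and sup-norm balls -/

namespace Cube

lemma toSet_eq_pi (Q : Cube d) :
    Q.toSet = Set.univ.pi fun i => Set.Ico (Q.corner i) (Q.corner i + Q.side) := by
  ext x; simp [toSet, Set.mem_pi]

lemma measurableSet_toSet (Q : Cube d) : MeasurableSet Q.toSet := by
  rw [toSet_eq_pi]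
  exact MeasurableSet.univ_pi fun i => measurableSet_Ico

lemma vol_eq (Q : Cube d) : Q.vol = ENNReal.ofReal Q.side ^ d := by
  simp [vol, toSet_eq_pi, Real.volume_pi_Ico]

lemma vol_ne_zero (Q : Cube d) : Q.vol ≠ 0 := by
  rw [vol_eq]
  exact pow_ne_zero _ (by simpa using Q.side_pos)

lemma vol_ne_top (Q : Cube d) : Q.vol ≠ ∞ := by
  rw [vol_eq]
  exact ENNReal.pow_ne_top ENNReal.ofReal_ne_top

/-- The centre of a cube. -/
def center (Q : Cube d) : Fin d → ℝ := fun i => Q.corner i + Q.side / 2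

lemma closedBall_center (Q : Cube d) (c : ℝ) (hc : 0 ≤ c) :
    Metric.closedBall Q.center (c * (Q.side / 2)) =
      Set.univ.pi fun i => Set.Icc (Q.center i - c * (Q.side / 2)) (Q.center i + c * (Q.side / 2)) := by
  rw [closedBall_pi _ (mul_nonneg hc (by linarith [Q.side_pos]))]
  simp [Real.closedBall_eq_Icc]

lemma toSet_subset_closedBall (Q : Cube d) :
    Q.toSet ⊆ Metric.closedBall Q.center (Q.side / 2) := by
  have := closedBall_center Q 1 zero_le_one
  rw [one_mul] at this
  rw [this]
  intro x hx i _
  have := hx i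
  simp only [center, Set.mem_Icc]
  constructor <;> linarith

/-- Cubes are balls of the sup norm up to a null set, so differentiation theorems stated for balls
apply to averages over cubes. -/
lemma toSet_ae_eq_closedBall (Q : Cube d) :
    Q.toSet =ᵐ[volume] Metric.closedBall Q.center (Q.side / 2) := by
  have := closedBall_center Q 1 zero_le_one
  rw [one_mul] at this
  rw [this, toSet_eq_pi]
  have h : ∀ i, Q.center i - Q.side / 2 = Q.corner i ∧
      Q.center i + Q.side / 2 = Q.corner i + Q.side := fun i => by
    simp only [center]; constructor <;> ring
  simp only [h]
  rw [Set.pi_univ_Icc]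
  exact Measure.univ_pi_Ico_ae_eq_Icc (μ := fun _ : Fin d => (volume : Measure ℝ))
    (f := Q.corner) (g := fun i => Q.corner i + Q.side)

lemma volume_closedBall_center (Q : Cube d) {c : ℝ} (hc : 0 ≤ c) :
    volume (Metric.closedBall Q.center (c * (Q.side / 2))) = ENNReal.ofReal c ^ d * Q.vol := by
  rw [closedBall_center _ _ hc, volume_pi_pi, vol_eq, ← mul_pow, ← ENNReal.ofReal_mul hc]
  have : ∀ i, Q.center i + c * (Q.side / 2) - (Q.center i - c * (Q.side / 2)) = c * Q.side := by
    intro i; ring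
  simp [Real.volume_Icc, this]

lemma exists_toSet_superset {K : Set (Fin d → ℝ)} (hK : Bornology.IsBounded K) :
    ∃ Q : Cube d, K ⊆ Q.toSet := by
  obtain ⟨r, hr⟩ := hK.subset_closedBall 0
  refine ⟨⟨fun _ => -|r|, 2 * |r| + 1, by positivity⟩, fun x hx i => ?_⟩
  have h1 := hr hx
  rw [mem_closedBall_zero_iff] at h1
  have h2 := abs_le.1 (((norm_le_pi_norm x i).trans h1).trans (le_abs_self r))
  simp only
  constructor <;> linarith [h2.1, h2.2]

/-- The dyadic children of a cube. -/
def child (Q : Cube d) (b : Fin d → Bool) : Cube d where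
  corner i := Q.corner i + if b i then Q.side / 2 else 0
  side := Q.side / 2
  side_pos := by linarith [Q.side_pos]

open Classical in
/-- The index of the dyadic child of `Q` that contains a given point of `Q`. -/
def childIndex (Q : Cube d) (x : Fin d → ℝ) : Fin d → Bool :=
  fun i => decide (Q.corner i + Q.side / 2 ≤ x i)

lemma mem_child_iff (Q : Cube d) (b : Fin d → Bool) (x : Fin d → ℝ) :
    x ∈ (Q.child b).toSet ↔ x ∈ Q.toSet ∧ Q.childIndex x = b := by
  simp only [toSet, Set.mem_ofPred_eq, child, funext_iff, childIndex, ← forall_and]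
  refine forall_congr' fun i => ?_
  have := Q.side_pos
  cases b i
  · simp only [decide_eq_false_iff_not, not_le, if_false, Bool.false_eq_true, add_zero]
    constructor
    · rintro ⟨h1, h2⟩; refine ⟨⟨h1, ?_⟩, h2⟩; linarith
    · rintro ⟨⟨h1, _⟩, h2⟩; exact ⟨h1, h2⟩
  · simp only [decide_eq_true_eq, if_true]
    constructor
    · rintro ⟨h1, h2⟩; refine ⟨⟨?_, ?_⟩, h1⟩ <;> linarith
    · rintro ⟨⟨_, h1⟩, h2⟩; refine ⟨h2, ?_⟩; linarith

lemma child_subset (Q : Cube d) (b : Fin d → Bool) : (Q.child b).toSet ⊆ Q.toSet :=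
  fun x hx => ((Q.mem_child_iff b x).1 hx).1

lemma mem_child_childIndex (Q : Cube d) {x : Fin d → ℝ} (hx : x ∈ Q.toSet) :
    x ∈ (Q.child (Q.childIndex x)).toSet :=
  (Q.mem_child_iff _ x).2 ⟨hx, rfl⟩

lemma iUnion_child (Q : Cube d) : ⋃ b, (Q.child b).toSet = Q.toSet := by
  ext x
  simp [mem_child_iff]

lemma pairwise_disjoint_child (Q : Cube d) :
    Pairwise (Function.onFun Disjoint fun b => (Q.child b).toSet) := by
  intro b c hbc
  refine Set.disjoint_left.2 fun x hb hc => hbc ?_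
  rw [← ((Q.mem_child_iff b x).1 hb).2, ((Q.mem_child_iff c x).1 hc).2]

lemma vol_child (Q : Cube d) (b : Fin d → Bool) : 2 ^ d * (Q.child b).vol = Q.vol := by
  rw [vol_eq, vol_eq, ← mul_pow]
  congr 1
  simp only [child]
  rw [show (2 : ℝ≥0∞) = ENNReal.ofReal 2 by simp, ← ENNReal.ofReal_mul (by norm_num)]
  congr 1; ring

lemma lintegral_eq_sum_child (Q : Cube d) (F : (Fin d → ℝ) → ℝ≥0∞) (μ : Measure (Fin d → ℝ)) :
    ∫⁻ x in Q.toSet, F x ∂μ = ∑ b, ∫⁻ x in (Q.child b).toSet, F x ∂μ := by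
  rw [← iUnion_child, lintegral_iUnion (fun b => (Q.child b).measurableSet_toSet)
    Q.pairwise_disjoint_child, tsum_fintype]

lemma measurable_childIndex (Q : Cube d) : Measurable Q.childIndex := by
  refine measurable_pi_lambda _ fun i => ?_
  refine measurable_to_bool ?_
  have : (fun x => Q.childIndex x i) ⁻¹' {true} = {x | Q.corner i + Q.side / 2 ≤ x i} := by
    ext x; simp [childIndex]
  rw [this]
  exact measurableSet_le measurable_const (measurable_pi_apply i)

end Cube

/-! ### Layer cake formulas -/

section LayerCake

variable {α : Type*} [MeasurableSpace α]

lemma lintegral_rpow_eq_lintegral_meas_lt (μ : Measure α) {M : α → ℝ≥0∞} (hM : AEMeasurable M μ)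
    (hfin : ∀ x, M x ≠ ∞) {p : ℝ} (hp : 0 < p) :
    ∫⁻ x, M x ^ p ∂μ = ENNReal.ofReal p *
      ∫⁻ t in Set.Ioi (0 : ℝ), μ {x | ENNReal.ofReal t < M x} * ENNReal.ofReal (t ^ (p - 1)) := by
  have h := lintegral_rpow_eq_lintegral_meas_lt_mul μ (f := fun x => (M x).toReal)
    (Filter.Eventually.of_forall fun x => ENNReal.toReal_nonneg) hM.ennreal_toReal hp
  have e : ∀ x, ENNReal.ofReal ((M x).toReal ^ p) = M x ^ p := fun x => by
    rw [← ENNReal.ofReal_rpow_of_nonneg ENNReal.toReal_nonneg hp.le, ENNReal.ofReal_toReal (hfin x)]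
  simp only [e] at h
  rw [h]
  congr 1
  refine setLIntegral_congr_fun measurableSet_Ioi fun t ht => ?_
  have : {x | t < (M x).toReal} = {x | ENNReal.ofReal t < M x} := by
    ext x
    exact (ENNReal.ofReal_lt_iff_lt_toReal (le_of_lt ht) (hfin x)).symm
  simp only [this]

/-- If the `μ`-measure of the level sets of `M` above height `t₀` is controlled by `K t` times
their `ν`-measure, then the `δ`-th moment for `μ` is controlled by the `1 + δ`-th one for `ν`. -/
lemma lintegral_rpow_le_of_meas_lt_le (μ ν : Measure α) {M : α → ℝ≥0∞} (hM : Measurable M)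
    (hfin : ∀ x, M x ≠ ∞) {δ : ℝ} (hδ : 0 < δ) {t₀ K : ℝ≥0∞} (ht₀ : t₀ ≠ ∞)
    (h : ∀ t : ℝ≥0∞, t₀ ≤ t → t ≠ ∞ → μ {x | t < M x} ≤ K * t * ν {x | t < M x}) :
    ∫⁻ x, M x ^ δ ∂μ ≤ t₀ ^ δ * μ Set.univ + K * ENNReal.ofReal δ * ∫⁻ x, M x ^ (1 + δ) ∂ν := by
  have hanti : ∀ (κ : Measure α) (N : α → ℝ≥0∞),
      Measurable fun t : ℝ => κ {x | ENNReal.ofReal t < N x} := fun κ N =>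
    Antitone.measurable fun s t hst => measure_mono fun x hx =>
      (ENNReal.ofReal_le_ofReal hst).trans_lt hx
  -- The term t₀^δ μ(univ) is itself written as a layer cake integral. It pays for the levels below
  -- t₀, where the hypothesis says nothing.
  have hc := lintegral_rpow_eq_lintegral_meas_lt μ (M := fun _ => t₀) aemeasurable_const
    (fun _ => ht₀) hδ
  rw [lintegral_const] at hc
  rw [lintegral_rpow_eq_lintegral_meas_lt μ hM.aemeasurable hfin hδ, hc,
    lintegral_rpow_eq_lintegral_meas_lt ν hM.aemeasurable hfin (by linarith : 0 < 1 + δ)]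
  have h1 : ∀ t ∈ Set.Ioi (0 : ℝ), μ {x | ENNReal.ofReal t < M x} * ENNReal.ofReal (t ^ (δ - 1)) ≤
      μ {_x | ENNReal.ofReal t < t₀} * ENNReal.ofReal (t ^ (δ - 1)) +
        K * (ν {x | ENNReal.ofReal t < M x} * ENNReal.ofReal (t ^ (1 + δ - 1))) := by
    intro t ht
    rcases lt_or_ge (ENNReal.ofReal t) t₀ with hlt | hge
    · refine le_add_right ?_
      gcongr ?_ * _
      exact measure_mono fun x _ => hlt
    · refine le_add_left ?_
      have e : ENNReal.ofReal (t ^ (1 + δ - 1)) =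
          ENNReal.ofReal t * ENNReal.ofReal (t ^ (δ - 1)) := by
        rw [← ENNReal.ofReal_mul (le_of_lt ht)]
        congr 1
        rw [show 1 + δ - 1 = 1 + (δ - 1) by ring, Real.rpow_add ht, Real.rpow_one]
      rw [e]
      calc _ ≤ K * ENNReal.ofReal t * ν {x | ENNReal.ofReal t < M x} *
            ENNReal.ofReal (t ^ (δ - 1)) := by
            gcongr
            exact h _ hge ENNReal.ofReal_ne_top
        _ = _ := by ring
  have hm : Measurable fun t : ℝ => ENNReal.ofReal (t ^ (δ - 1)) := by fun_prop
  have hm' : Measurable fun t : ℝ => ENNReal.ofReal (t ^ (1 + δ - 1)) := by fun_prop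
  have h2 := setLIntegral_mono' (μ := volume) measurableSet_Ioi h1
  have hm1 : Measurable fun t : ℝ => μ {_x | ENNReal.ofReal t < t₀} *
      ENNReal.ofReal (t ^ (δ - 1)) := (hanti μ fun _ => t₀).mul hm
  have hm2 : Measurable fun t : ℝ => ν {x | ENNReal.ofReal t < M x} *
      ENNReal.ofReal (t ^ (1 + δ - 1)) := (hanti ν M).mul hm'
  rw [lintegral_add_left hm1, lintegral_const_mul _ hm2] at h2
  calc _ ≤ _ := mul_le_mul_right h2 _
    _ = ENNReal.ofReal δ * (∫⁻ t in Set.Ioi (0 : ℝ), μ {_x | ENNReal.ofReal t < t₀} *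
          ENNReal.ofReal (t ^ (δ - 1))) + K * ENNReal.ofReal δ * (1 *
          ∫⁻ t in Set.Ioi (0 : ℝ), ν {x | ENNReal.ofReal t < M x} *
          ENNReal.ofReal (t ^ (1 + δ - 1))) := by ring
    _ ≤ _ := by
      gcongr
      rw [← ENNReal.ofReal_one]
      exact ENNReal.ofReal_le_ofReal (by linarith)

end LayerCake

/-! ### Dyadic maximal functions and the sharp reverse Hölder inequality -/

/-- The average of a nonnegative function over a cube. -/
def lavg (w : (Fin d → ℝ) → ℝ≥0∞) (Q : Cube d) : ℝ≥0∞ := (∫⁻ x in Q.toSet, w x) / Q.vol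

lemma lavg_mul_vol (w : (Fin d → ℝ) → ℝ≥0∞) (Q : Cube d) :
    lavg w Q * Q.vol = ∫⁻ x in Q.toSet, w x :=
  ENNReal.div_mul_cancel Q.vol_ne_zero Q.vol_ne_top

lemma lavg_ne_top {w : (Fin d → ℝ) → ℝ≥0∞} {Q : Cube d} (h : ∫⁻ x in Q.toSet, w x ≠ ∞) :
    lavg w Q ≠ ∞ :=
  ENNReal.div_ne_top h Q.vol_ne_zero

/-- The dyadic maximal function of a cube, over its dyadic subcubes of generation at most `k`. -/
def dyMax (w : (Fin d → ℝ) → ℝ≥0∞) : ℕ → Cube d → (Fin d → ℝ) → ℝ≥0∞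
  | 0, Q, _ => lavg w Q
  | k + 1, Q, x => max (lavg w Q) (dyMax w k (Q.child (Q.childIndex x)) x)

lemma measurable_dyMax (w : (Fin d → ℝ) → ℝ≥0∞) (k : ℕ) (Q : Cube d) :
    Measurable (dyMax w k Q) := by
  induction k generalizing Q with
  | zero => exact measurable_const
  | succ k ih =>
    refine Measurable.max measurable_const ?_
    -- The child in the recursion depends on the point, so its index is made a separate variable
    -- with finitely many values.
    have : Measurable fun p : (Fin d → Bool) × (Fin d → ℝ) => dyMax w k (Q.child p.1) p.2 :=
      measurable_from_prod_countable_right fun b => ih (Q.child b)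
    exact this.comp (Q.measurable_childIndex.prodMk measurable_id)

lemma dyMax_le_succ (w : (Fin d → ℝ) → ℝ≥0∞) (k : ℕ) (Q : Cube d) (x : Fin d → ℝ) :
    dyMax w k Q x ≤ dyMax w (k + 1) Q x := by
  induction k generalizing Q with
  | zero => exact le_max_left _ _
  | succ k ih => exact max_le_max le_rfl (ih _)

lemma monotone_dyMax (w : (Fin d → ℝ) → ℝ≥0∞) (Q : Cube d) (x : Fin d → ℝ) :
    Monotone fun k => dyMax w k Q x :=
  monotone_nat_of_le_succ fun k => dyMax_le_succ w k Q x

lemma lavg_le_dyMax (w : (Fin d → ℝ) → ℝ≥0∞) (k : ℕ) (Q : Cube d) (x : Fin d → ℝ) :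
    lavg w Q ≤ dyMax w k Q x := by
  cases k
  · exact le_rfl
  · exact le_max_left _ _

lemma dyMax_ne_top {w : (Fin d → ℝ) → ℝ≥0∞} (hw : ∀ Q : Cube d, ∫⁻ x in Q.toSet, w x ≠ ∞)
    (k : ℕ) (Q : Cube d) (x : Fin d → ℝ) : dyMax w k Q x ≠ ∞ := by
  induction k generalizing Q with
  | zero => exact lavg_ne_top (hw Q)
  | succ k ih => exact (max_lt (lavg_ne_top (hw Q)).lt_top (ih _).lt_top).ne

/-- Only subcubes of P that contain x enter the recursion. This is how the dyadic maximal function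
is compared with M(w 1_P). -/
lemma dyMax_le {w : (Fin d → ℝ) → ℝ≥0∞} {B : ℝ≥0∞} {P : Cube d} {x : Fin d → ℝ}
    (h : ∀ R : Cube d, x ∈ R.toSet → R.toSet ⊆ P.toSet → lavg w R ≤ B) (k : ℕ) (Q : Cube d)
    (hx : x ∈ Q.toSet) (hQ : Q.toSet ⊆ P.toSet) : dyMax w k Q x ≤ B := by
  induction k generalizing Q with
  | zero => exact h Q hx hQ
  | succ k ih =>
    exact max_le (h Q hx hQ) (ih _ (Q.mem_child_childIndex hx) ((Q.child_subset _).trans hQ))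

/-- A dyadic bound for functions `H k Q` on cubes, with mass controlled by that of `w`, which are
inherited by the children on which the maximal function exceeds `t ≥ w_Q`. -/
lemma lintegral_indicator_dyMax_le {w : (Fin d → ℝ) → ℝ≥0∞}
    {H : ℕ → Cube d → (Fin d → ℝ) → ℝ≥0∞} {A : ℝ≥0∞}
    (hA : ∀ k Q, ∫⁻ x in Q.toSet, H k Q x ≤ A * ∫⁻ x in Q.toSet, w x) {t : ℝ≥0∞}
    (hH : ∀ k Q x, lavg w Q ≤ t → t < dyMax w (k + 1) Q x →
      H (k + 1) Q x = H k (Q.child (Q.childIndex x)) x)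
    (k : ℕ) (Q : Cube d) (hQ : lavg w Q ≤ t) :
    ∫⁻ x in Q.toSet, {x | t < dyMax w k Q x}.indicator (H k Q) x ≤
      A * 2 ^ d * t * ∫⁻ x in Q.toSet, {x | t < dyMax w k Q x}.indicator 1 x := by
  induction k generalizing Q with
  | zero =>
    have : {x | t < dyMax w 0 Q x} = ∅ := by
      ext x; simpa [dyMax] using hQ
    simp [this]
  | succ k ih =>
    rw [Q.lintegral_eq_sum_child, Q.lintegral_eq_sum_child, Finset.mul_sum]
    refine Finset.sum_le_sum fun b _ => ?_
    have hiff : ∀ x ∈ (Q.child b).toSet, (t < dyMax w (k + 1) Q x ↔ t < dyMax w k (Q.child b) x) := by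
      intro x hx
      rw [dyMax, ((Q.mem_child_iff b x).1 hx).2, lt_max_iff]
      simp [hQ.not_gt]
    have e1 : ∫⁻ x in (Q.child b).toSet, {x | t < dyMax w (k + 1) Q x}.indicator (H (k + 1) Q) x =
        ∫⁻ x in (Q.child b).toSet, {x | t < dyMax w k (Q.child b) x}.indicator (H k (Q.child b)) x := by
      refine setLIntegral_congr_fun (Q.child b).measurableSet_toSet fun x hx => ?_
      by_cases hlt : t < dyMax w (k + 1) Q x
      · rw [Set.indicator_of_mem (by exact hlt), Set.indicator_of_mem (by exact (hiff x hx).1 hlt),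
          hH k Q x hQ hlt, ((Q.mem_child_iff b x).1 hx).2]
      · rw [Set.indicator_of_notMem (by exact hlt),
          Set.indicator_of_notMem (by exact fun h => hlt ((hiff x hx).2 h))]
    have e2 : ∫⁻ x in (Q.child b).toSet, {x | t < dyMax w (k + 1) Q x}.indicator 1 x =
        ∫⁻ x in (Q.child b).toSet,
          {x | t < dyMax w k (Q.child b) x}.indicator (1 : (Fin d → ℝ) → ℝ≥0∞) x := by
      refine setLIntegral_congr_fun (Q.child b).measurableSet_toSet fun x hx => ?_
      by_cases hlt : t < dyMax w (k + 1) Q x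
      · rw [Set.indicator_of_mem (by exact hlt), Set.indicator_of_mem (by exact (hiff x hx).1 hlt)]
      · rw [Set.indicator_of_notMem (by exact hlt),
          Set.indicator_of_notMem (by exact fun h => hlt ((hiff x hx).2 h))]
    rw [e1, e2]
    -- Calderón-Zygmund stopping: a child with average at most t is handled by induction. Any other
    -- child lies entirely in the level set, and its mass is at most A w(Q) ≤ A t|Q|, where |Q| is
    -- 2^d times the volume of the child.
    rcases le_or_gt (lavg w (Q.child b)) t with hb | hb
    · exact ih _ hb
    · have hu : {x | t < dyMax w k (Q.child b) x} = Set.univ := by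
        ext x
        simpa using hb.trans_le (lavg_le_dyMax w k (Q.child b) x)
      rw [hu, Set.indicator_univ, Set.indicator_univ]
      simp only [Pi.one_apply, lintegral_one, Measure.restrict_apply, MeasurableSet.univ,
        Set.univ_inter]
      calc ∫⁻ x in (Q.child b).toSet, H k (Q.child b) x
          ≤ A * ∫⁻ x in (Q.child b).toSet, w x := hA _ _
        _ ≤ A * ∫⁻ x in Q.toSet, w x := by gcongr; exact Q.child_subset b
        _ = A * (lavg w Q * Q.vol) := by rw [lavg_mul_vol]
        _ ≤ A * (t * Q.vol) := by gcongr
        _ = A * 2 ^ d * t * (Q.child b).vol := by rw [← Q.vol_child b]; ring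

lemma withDensity_restrict_meas_lt {w F : (Fin d → ℝ) → ℝ≥0∞} (k : ℕ) (Q : Cube d) (t : ℝ≥0∞) :
    ((volume.restrict Q.toSet).withDensity F) {x | t < dyMax w k Q x} =
      ∫⁻ x in Q.toSet, {x | t < dyMax w k Q x}.indicator F x := by
  have hm : MeasurableSet {x | t < dyMax w k Q x} :=
    measurableSet_lt measurable_const (measurable_dyMax w k Q)
  rw [withDensity_apply _ hm, lintegral_indicator hm]

lemma meas_lt_dyMax {w : (Fin d → ℝ) → ℝ≥0∞} (k : ℕ) (Q : Cube d) (t : ℝ≥0∞) :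
    (volume.restrict Q.toSet) {x | t < dyMax w k Q x} =
      ∫⁻ x in Q.toSet, {x | t < dyMax w k Q x}.indicator 1 x := by
  have hm : MeasurableSet {x | t < dyMax w k Q x} :=
    measurableSet_lt measurable_const (measurable_dyMax w k Q)
  rw [lintegral_indicator_one hm]

/-- The sharp reverse Hölder inequality, for the truncated dyadic maximal function. -/
lemma lintegral_dyMax_rpow_mul_le {w : (Fin d → ℝ) → ℝ≥0∞} (hwm : Measurable w)
    (hw : ∀ Q : Cube d, ∫⁻ x in Q.toSet, w x ≠ ∞) {A : ℝ≥0∞}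
    (hA : ∀ k (Q : Cube d), ∫⁻ x in Q.toSet, dyMax w k Q x ≤ A * ∫⁻ x in Q.toSet, w x)
    {δ : ℝ} (hδ : 0 < δ) (hδA : A * 2 ^ d * ENNReal.ofReal δ ≤ 1 / 2) (k : ℕ) (Q : Cube d) :
    ∫⁻ x in Q.toSet, dyMax w k Q x ^ δ * w x ≤ 2 * lavg w Q ^ (1 + δ) * Q.vol := by
  have hδ1 : 2 ^ d * ENNReal.ofReal δ * (2 * A) ≤ 1 := by
    calc _ = 2 * (A * 2 ^ d * ENNReal.ofReal δ) := by ring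
      _ ≤ 2 * (1 / 2) := by gcongr
      _ = 1 := ENNReal.mul_div_cancel (by simp) (by simp)
  set M := dyMax w k Q with hMdef
  have hMm : Measurable M := measurable_dyMax w k Q
  have hfin : ∀ x, M x ≠ ∞ := dyMax_ne_top hw k Q
  have hQ := lavg_ne_top (hw Q)
  set a := lavg w Q with ha
  have hpow : a ^ (1 + δ) = a ^ δ * a := by
    rw [add_comm, ENNReal.rpow_add_of_nonneg _ _ hδ.le zero_le_one, ENNReal.rpow_one]
  set X := ∫⁻ x in Q.toSet, M x ^ (1 + δ) with hX
  -- Finiteness is needed to absorb X/2 below. It is the reason for truncating at generation k: the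
  -- truncated maximal function is bounded by a finite sum of averages.
  have hXfin : X ≠ ∞ := by
    have hb : ∃ B : ℝ≥0∞, B ≠ ∞ ∧ ∀ x, M x ≤ B := by
      rw [hMdef]
      clear_value X a
      clear hX hMdef ha hMm hfin hQ hpow M
      induction k generalizing Q with
      | zero => exact ⟨lavg w Q, lavg_ne_top (hw Q), fun x => le_rfl⟩
      | succ k ih =>
        choose B hB hB' using fun b => ih (Q.child b)
        refine ⟨lavg w Q + ∑ b, B b, ENNReal.add_ne_top.2 ⟨lavg_ne_top (hw Q),
          (ENNReal.sum_ne_top.2 fun b _ => hB b)⟩, fun x => max_le le_self_add ?_⟩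
        refine (hB' _ x).trans (le_add_left ?_)
        exact Finset.single_le_sum (f := B) (fun _ _ => zero_le) (Finset.mem_univ _)
    obtain ⟨B, hB, hMB⟩ := hb
    refine ne_top_of_le_ne_top (b := B ^ (1 + δ) * Q.vol) (ENNReal.mul_ne_top
      (ENNReal.rpow_ne_top_of_nonneg (by linarith) hB) Q.vol_ne_top) ?_
    calc X ≤ ∫⁻ _x in Q.toSet, B ^ (1 + δ) := by
          refine lintegral_mono fun x => ?_
          exact ENNReal.rpow_le_rpow (hMB x) (by linarith)
      _ = _ := by rw [setLIntegral_const]; rfl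
  -- The level set estimate is applied to the measure M dx. The A_∞ condition bounds its total mass,
  -- and the smallness of δ makes the coefficient of X on the right at most 1/2.
  have h1 : X ≤ 2 * A * (a ^ (1 + δ) * Q.vol) := by
    have := lintegral_rpow_le_of_meas_lt_le ((volume.restrict Q.toSet).withDensity M)
      (volume.restrict Q.toSet) hMm hfin hδ hQ (K := A * 2 ^ d) (fun t ht _ => by
        rw [withDensity_restrict_meas_lt, meas_lt_dyMax]
        refine lintegral_indicator_dyMax_le hA (fun k Q x h1 h2 => ?_) k Q ht
        rw [dyMax] at h2 ⊢
        exact max_eq_right (h1.trans ((lt_max_iff.1 h2).resolve_left h1.not_gt).le))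
    rw [lintegral_withDensity_eq_lintegral_mul _ hMm (hMm.pow_const δ),
      withDensity_apply _ MeasurableSet.univ, Measure.restrict_univ] at this
    have e : ∫⁻ x in Q.toSet, (M * fun x => M x ^ δ) x = X := by
      refine lintegral_congr fun x => ?_
      rw [Pi.mul_apply, ENNReal.rpow_add_of_nonneg _ _ zero_le_one hδ.le, ENNReal.rpow_one]
    rw [e] at this
    have h2 : X ≤ a ^ δ * (A * (a * Q.vol)) + 1 / 2 * X := by
      refine this.trans ?_
      gcongr
      rw [lavg_mul_vol]
      exact hA k Q
    have h3 : X / 2 ≤ a ^ δ * (A * (a * Q.vol)) := by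
      have : X / 2 + X / 2 ≤ a ^ δ * (A * (a * Q.vol)) + X / 2 := by
        rw [ENNReal.add_halves]
        refine h2.trans (le_of_eq ?_)
        rw [ENNReal.div_eq_inv_mul, ENNReal.div_eq_inv_mul, mul_one]
      exact (ENNReal.add_le_add_iff_right (ENNReal.div_ne_top hXfin (by simp))).1 this
    calc X = 2 * (X / 2) := by rw [ENNReal.mul_div_cancel (by simp) (by simp)]
      _ ≤ 2 * (a ^ δ * (A * (a * Q.vol))) := by gcongr
      _ = _ := by rw [hpow]; ring
  -- The same estimate for w dx, now with constant 2^d and no factor A; the bound for X controls the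
  -- last term.
  have := lintegral_rpow_le_of_meas_lt_le ((volume.restrict Q.toSet).withDensity w)
      (volume.restrict Q.toSet) hMm hfin hδ hQ (K := 1 * 2 ^ d) (fun t ht _ => by
        rw [withDensity_restrict_meas_lt, meas_lt_dyMax]
        exact lintegral_indicator_dyMax_le (H := fun _ _ => w) (fun k Q => by rw [one_mul])
          (fun k Q x h1 h2 => rfl) k Q ht)
  rw [lintegral_withDensity_eq_lintegral_mul _ hwm (hMm.pow_const δ),
      withDensity_apply _ MeasurableSet.univ, Measure.restrict_univ, one_mul, ← lavg_mul_vol w] at this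
  calc ∫⁻ x in Q.toSet, M x ^ δ * w x = ∫⁻ x in Q.toSet, (w * fun x => M x ^ δ) x :=
        lintegral_congr fun x => mul_comm _ _
    _ ≤ a ^ δ * (a * Q.vol) + 2 ^ d * ENNReal.ofReal δ * X := this
    _ ≤ a ^ δ * (a * Q.vol) + 2 ^ d * ENNReal.ofReal δ * (2 * A * (a ^ (1 + δ) * Q.vol)) := by
      gcongr
    _ = a ^ (1 + δ) * Q.vol + (2 ^ d * ENNReal.ofReal δ * (2 * A)) * (a ^ (1 + δ) * Q.vol) := by
      rw [hpow]; ring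
    _ ≤ a ^ (1 + δ) * Q.vol + 1 * (a ^ (1 + δ) * Q.vol) := by gcongr
    _ = _ := by ring

/-- The dyadic subcube of `Q` of generation `k` that contains a given point of `Q`. -/
def Cube.dyadic (x : Fin d → ℝ) : ℕ → Cube d → Cube d
  | 0, Q => Q
  | k + 1, Q => Cube.dyadic x k (Q.child (Q.childIndex x))

lemma Cube.side_dyadic (x : Fin d → ℝ) (k : ℕ) (Q : Cube d) :
    (Cube.dyadic x k Q).side = Q.side / 2 ^ k := by
  induction k generalizing Q with
  | zero => simp [dyadic]
  | succ k ih =>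
    rw [dyadic, ih, pow_succ']
    simp only [child]
    rw [div_div]

lemma Cube.mem_dyadic {x : Fin d → ℝ} (k : ℕ) (Q : Cube d) (hx : x ∈ Q.toSet) :
    x ∈ (Cube.dyadic x k Q).toSet := by
  induction k generalizing Q with
  | zero => exact hx
  | succ k ih => exact ih _ (Q.mem_child_childIndex hx)

lemma lavg_dyadic_le (w : (Fin d → ℝ) → ℝ≥0∞) (x : Fin d → ℝ) (k : ℕ) (Q : Cube d) :
    lavg w (Cube.dyadic x k Q) ≤ dyMax w k Q x := by
  induction k generalizing Q with
  | zero => exact le_rfl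
  | succ k ih => exact (ih _).trans (le_max_right _ _)

lemma locallyIntegrable_toReal {w : (Fin d → ℝ) → ℝ≥0∞} (hwm : Measurable w)
    (hw : ∀ Q : Cube d, ∫⁻ x in Q.toSet, w x ≠ ∞) :
    LocallyIntegrable (fun x => (w x).toReal) volume := by
  rw [locallyIntegrable_iff]
  intro K hK
  obtain ⟨Q, hQ⟩ := Cube.exists_toSet_superset hK.isBounded
  exact (integrable_toReal_of_lintegral_ne_top hwm.aemeasurable (hw Q)).mono_measure
    (Measure.restrict_mono hQ le_rfl)

lemma average_closedBall_eq {w : (Fin d → ℝ) → ℝ≥0∞} (hwm : Measurable w)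
    (hwf : ∀ x, w x ≠ ∞) (Q : Cube d) :
    ⨍ x in Metric.closedBall Q.center (Q.side / 2), (w x).toReal = (lavg w Q).toReal := by
  rw [setAverage_congr Q.toSet_ae_eq_closedBall.symm, setAverage_eq,
    integral_toReal hwm.aemeasurable (Filter.Eventually.of_forall fun x => (hwf x).lt_top), lavg,
    ENNReal.toReal_div, smul_eq_mul, mul_comm, div_eq_mul_inv]
  rfl

/-- A form of Lebesgue's differentiation theorem, for the dyadic maximal function. -/
lemma ae_le_iSup_dyMax {w : (Fin d → ℝ) → ℝ≥0∞} (hwm : Measurable w) (hwf : ∀ x, w x ≠ ∞)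
    (hw : ∀ Q : Cube d, ∫⁻ x in Q.toSet, w x ≠ ∞) (Q : Cube d) :
    ∀ᵐ x, x ∈ Q.toSet → w x ≤ ⨆ k, dyMax w k Q x := by
  filter_upwards [IsUnifLocDoublingMeasure.ae_tendsto_average (μ := volume)
    (locallyIntegrable_toReal hwm hw) 1] with x hx hxQ
  have hlim : Filter.Tendsto (fun k => (Cube.dyadic x k Q).side / 2) Filter.atTop
      (nhdsWithin 0 (Set.Ioi 0)) := by
    refine tendsto_nhdsWithin_iff.2 ⟨?_, Filter.Eventually.of_forall fun k =>
      half_pos (Cube.side_pos _)⟩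
    simp only [Cube.side_dyadic]
    have := (tendsto_pow_atTop_nhds_zero_of_lt_one (r := (1 / 2 : ℝ)) (by norm_num)
      (by norm_num)).const_mul (Q.side / 2)
    rw [mul_zero] at this
    refine this.congr fun k => ?_
    rw [one_div, inv_pow]
    field_simp
  -- The balls are centred at the centres of the dyadic cubes, not at x; the differentiation theorem
  -- only needs x to lie in them.
  have ht := hx (fun k => (Cube.dyadic x k Q).center) _ hlim
    (Filter.Eventually.of_forall fun k => by
      rw [one_mul]
      exact (Cube.dyadic x k Q).toSet_subset_closedBall (Cube.mem_dyadic k Q hxQ))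
  by_cases htop : ⨆ k, dyMax w k Q x = ∞
  · rw [htop]; exact le_top
  have := le_of_tendsto' ht (b := (⨆ k, dyMax w k Q x).toReal) fun k => by
    rw [average_closedBall_eq hwm hwf]
    exact ENNReal.toReal_mono htop ((lavg_dyadic_le w x k Q).trans (le_iSup (fun k => dyMax w k Q x) k))
  exact (ENNReal.toReal_le_toReal (hwf x) htop).1 this

/-- By differentiation w^{1+δ} ≤ (sup_k M_k)^δ w almost everywhere, and monotone convergence lets
the truncated inequality pass to the limit because its bound does not depend on k. -/
lemma lintegral_rpow_le_of_dyMax {w : (Fin d → ℝ) → ℝ≥0∞} (hwm : Measurable w)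
    (hwf : ∀ x, w x ≠ ∞) (hw : ∀ Q : Cube d, ∫⁻ x in Q.toSet, w x ≠ ∞) {A : ℝ≥0∞}
    (hA : ∀ k (Q : Cube d), ∫⁻ x in Q.toSet, dyMax w k Q x ≤ A * ∫⁻ x in Q.toSet, w x)
    {δ : ℝ} (hδ : 0 < δ) (hδA : A * 2 ^ d * ENNReal.ofReal δ ≤ 1 / 2) (Q : Cube d) :
    ∫⁻ x in Q.toSet, w x ^ (1 + δ) ≤ 2 * lavg w Q ^ (1 + δ) * Q.vol := by
  calc ∫⁻ x in Q.toSet, w x ^ (1 + δ) ≤ ∫⁻ x in Q.toSet, ⨆ k, dyMax w k Q x ^ δ * w x := by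
        refine lintegral_mono_ae ?_
        filter_upwards [(ae_restrict_iff' Q.measurableSet_toSet).2 (ae_le_iSup_dyMax hwm hwf hw Q)]
          with x hx
        rw [← ENNReal.iSup_mul, add_comm, ENNReal.rpow_add_of_nonneg _ _ hδ.le zero_le_one,
          ENNReal.rpow_one]
        gcongr
        have := (ENNReal.orderIsoRpow δ hδ).map_iSup fun k => dyMax w k Q x
        simp only [ENNReal.orderIsoRpow_apply] at this
        rw [← this]
        gcongr
    _ = ⨆ k, ∫⁻ x in Q.toSet, dyMax w k Q x ^ δ * w x := by
        refine lintegral_iSup (fun k => ((measurable_dyMax w k Q).pow_const δ).mul hwm) ?_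
        intro k l hkl x
        have := monotone_dyMax w Q x hkl
        simp only at this ⊢
        gcongr
    _ ≤ _ := iSup_le fun k => lintegral_dyMax_rpow_mul_le hwm hw hA hδ hδA k Q

lemma normAvg_one_indicator {u : (Fin d → ℝ) → ℝ} (hu0 : 0 ≤ᵐ[volume] u) {R Q : Cube d}
    (hRQ : R.toSet ⊆ Q.toSet) :
    normAvg 1 R (Q.toSet.indicator u) = lavg (fun x => ENNReal.ofReal (u x)) R := by
  rw [normAvg, lavg, eLpNorm_one_eq_lintegral_enorm, Set.indicator_indicator,
    Set.inter_eq_left.2 hRQ]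
  congr 1
  · simp_rw [enorm_indicator_eq_indicator_enorm]
    rw [lintegral_indicator R.measurableSet_toSet]
    refine lintegral_congr_ae (ae_restrict_of_ae ?_)
    filter_upwards [hu0] with x hx
    exact Real.enorm_of_nonneg hx
  · simp

/-- The sharp reverse Hölder inequality for scalar `A_∞` weights. -/
theorem reverse_holder {u : (Fin d → ℝ) → ℝ} (hu : LocallyIntegrable u volume)
    (hu0 : 0 ≤ᵐ[volume] u) {A : ℝ≥0∞} (hA : ainfConst u ≤ A) {δ : ℝ} (hδ : 0 < δ)
    (hδA : A * 2 ^ d * ENNReal.ofReal δ ≤ 1 / 2) (Q : Cube d) :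
    ∫⁻ x in Q.toSet, ENNReal.ofReal (u x) ^ (1 + δ) ≤
      2 * lavg (fun x => ENNReal.ofReal (u x)) Q ^ (1 + δ) * Q.vol := by
  set v := hu.aestronglyMeasurable.mk u with hv
  have huv : u =ᵐ[volume] v := hu.aestronglyMeasurable.ae_eq_mk
  set w : (Fin d → ℝ) → ℝ≥0∞ := fun x => ENNReal.ofReal (v x) with hw
  have hwm : Measurable w := hu.aestronglyMeasurable.stronglyMeasurable_mk.measurable.ennreal_ofReal
  have hint : ∀ Q : Cube d, ∫⁻ x in Q.toSet, w x = ∫⁻ x in Q.toSet, ENNReal.ofReal (u x) :=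
    fun Q => lintegral_congr_ae (ae_restrict_of_ae (huv.mono fun x hx => by simp only [hw, hx]))
  have hlavg : lavg w = lavg fun x => ENNReal.ofReal (u x) := by
    ext Q; rw [lavg, lavg, hint]
  have hfin : ∀ Q : Cube d, ∫⁻ x in Q.toSet, w x ≠ ∞ := by
    intro Q
    rw [hint]
    have h1 : IntegrableOn u Q.toSet volume :=
      (hu.integrableOn_isCompact (isCompact_closedBall Q.center (Q.side / 2))).mono_set
        Q.toSet_subset_closedBall
    refine ne_top_of_le_ne_top h1.2.ne (lintegral_mono fun x => ?_)
    rw [← ofReal_norm]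
    exact ENNReal.ofReal_le_ofReal (le_abs_self _)
  have key : ∀ k (Q : Cube d), ∫⁻ x in Q.toSet, dyMax w k Q x ≤ A * ∫⁻ x in Q.toSet, w x := by
    intro k Q
    -- A cube of zero mass contributes 0/0 = 0 to the A_∞ constant, which gives no information, but
    -- there the dyadic maximal function vanishes.
    by_cases h0 : ∫⁻ x in Q.toSet, w x = 0
    · have : ∫⁻ x in Q.toSet, dyMax w k Q x = 0 := by
        rw [setLIntegral_congr_fun (g := fun _ => 0) Q.measurableSet_toSet, lintegral_zero]
        intro x hx
        refine le_antisymm (dyMax_le (P := Q) (fun R _ hR => ?_) k Q hx le_rfl) zero_le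
        rw [lavg, le_zero_iff, ENNReal.div_eq_zero_iff]
        left
        refine le_antisymm ?_ zero_le
        rw [← h0]
        exact lintegral_mono_set hR
      rw [this]; exact zero_le
    · have h1 := (le_iSup (fun Q : Cube d => (∫⁻ x in Q.toSet, maximalFn (Q.toSet.indicator u) x) /
        ∫⁻ x in Q.toSet, ENNReal.ofReal (u x)) Q).trans hA
      rw [← hint, ENNReal.div_le_iff h0 (hfin Q)] at h1
      refine le_trans (setLIntegral_mono' Q.measurableSet_toSet fun x hx => ?_) h1
      refine dyMax_le (P := Q) (fun R hxR hR => ?_) k Q hx le_rfl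
      rw [hlavg, ← normAvg_one_indicator hu0 hR]
      exact le_iSup₂ (f := fun (R : Cube d) (_ : x ∈ R.toSet) =>
        normAvg 1 R (Q.toSet.indicator u)) R hxR
  have := lintegral_rpow_le_of_dyMax hwm (fun x => ENNReal.ofReal_ne_top) hfin key hδ hδA Q
  rw [hlavg] at this
  refine le_trans (le_of_eq ?_) this
  exact lintegral_congr_ae (ae_restrict_of_ae (huv.mono fun x hx => by simp only [hw, hx]))

/-! ### Maximal inequality and Carleson embedding -/

/-- The maximal function of `h` over a finite family of cubes. -/
def finMax (h : (Fin d → ℝ) → ℝ≥0∞) (F : Finset (Cube d)) (x : Fin d → ℝ) : ℝ≥0∞ :=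
  F.sup fun Q => Q.toSet.indicator (fun _ => lavg h Q) x

lemma measurable_finMax (h : (Fin d → ℝ) → ℝ≥0∞) (F : Finset (Cube d)) :
    Measurable (finMax h F) := by
  have : finMax h F = F.sup fun Q => Q.toSet.indicator fun _ => lavg h Q := by
    ext x; simp [finMax, Finset.sup_apply]
  rw [this]
  exact Finset.sup_induction measurable_const (fun _ hf _ hg => hf.sup hg)
    fun Q _ => measurable_const.indicator Q.measurableSet_toSet

lemma lavg_le_finMax (h : (Fin d → ℝ) → ℝ≥0∞) {F : Finset (Cube d)} {Q : Cube d} (hQ : Q ∈ F)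
    {x : Fin d → ℝ} (hx : x ∈ Q.toSet) : lavg h Q ≤ finMax h F x := by
  have := Finset.le_sup (f := fun Q : Cube d => Q.toSet.indicator (fun _ => lavg h Q) x) hQ
  simp only [Set.indicator_of_mem hx] at this
  exact this

lemma finMax_ne_top {h : (Fin d → ℝ) → ℝ≥0∞} {F : Finset (Cube d)}
    (hF : ∀ Q ∈ F, lavg h Q ≠ ∞) (x : Fin d → ℝ) : finMax h F x ≠ ∞ := by
  refine ((Finset.sup_lt_iff (by simp)).2 fun Q hQ => ?_).ne
  by_cases hx : x ∈ Q.toSet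
  · simpa [hx] using (hF Q hQ).lt_top
  · simp [hx]

/-- The part of h below t/2 contributes at most t|Q|/2 to its integral over Q. Keeping only the
large values of h on the right makes the weak type bound strong enough to integrate in t. -/
lemma mul_vol_le_of_lt_lavg {h : (Fin d → ℝ) → ℝ≥0∞} (hm : Measurable h) {Q : Cube d} {t : ℝ≥0∞}
    (ht : t ≠ ∞) (hQ : t < lavg h Q) :
    t * Q.vol ≤ 2 * ∫⁻ x in Q.toSet, {x | t < 2 * h x}.indicator h x := by
  have hms : MeasurableSet {x | t < 2 * h x} := measurableSet_lt measurable_const (hm.const_mul 2)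
  have h1 : t * Q.vol ≤ ∫⁻ x in Q.toSet, h x := by
    rw [← lavg_mul_vol]; gcongr
  have h2 : ∫⁻ x in Q.toSet, h x ≤
      (∫⁻ x in Q.toSet, {x | t < 2 * h x}.indicator h x) + t / 2 * Q.vol := by
    calc ∫⁻ x in Q.toSet, h x
        ≤ ∫⁻ x in Q.toSet, ({x | t < 2 * h x}.indicator h x + t / 2) := by
          refine lintegral_mono fun x => ?_
          by_cases hx : t < 2 * h x
          · rw [Set.indicator_of_mem (by exact hx)]; exact le_self_add
          · rw [Set.indicator_of_notMem (by exact hx), zero_add,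
              ENNReal.le_div_iff_mul_le (by simp) (by simp), mul_comm]
            exact not_lt.1 hx
      _ = _ := by
          rw [lintegral_add_left (hm.indicator hms), setLIntegral_const]; rfl
  have h3 : t * Q.vol = t / 2 * Q.vol + t / 2 * Q.vol := by
    rw [← add_mul, ENNReal.add_halves]
  have h4 : t / 2 * Q.vol ≤ ∫⁻ x in Q.toSet, {x | t < 2 * h x}.indicator h x := by
    rw [h3] at h1
    exact (ENNReal.add_le_add_iff_right
      (ENNReal.mul_ne_top (ENNReal.div_ne_top ht (by simp)) Q.vol_ne_top)).1 (h1.trans h2)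
  rw [h3, two_mul]
  exact add_le_add h4 h4

/-- The weak type inequality for maximal functions over cubes, by Vitali's covering lemma. -/
lemma mul_volume_lt_finMax_le {h : (Fin d → ℝ) → ℝ≥0∞} (hm : Measurable h) (F : Finset (Cube d))
    {t : ℝ≥0∞} (ht : t ≠ ∞) :
    t * volume {x | t < finMax h F x} ≤
      2 * 5 ^ d * (volume.withDensity h) {x | t < 2 * h x} := by
  classical
  have hms : MeasurableSet {x | t < 2 * h x} := measurableSet_lt measurable_const (hm.const_mul 2)
  set G := F.filter fun Q => t < lavg h Q with hG
  -- The sum of all the half-sides serves merely as a common bound for the radii.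
  obtain ⟨u, huG, hdisj, hcov⟩ := Vitali.exists_disjoint_subfamily_covering_enlargement_closedBall
    (G : Set (Cube d)) Cube.center (fun Q => Q.side / 2) (∑ Q ∈ G, Q.side / 2)
    (fun Q hQ => Finset.single_le_sum (f := fun Q : Cube d => Q.side / 2)
      (fun R _ => (half_pos R.side_pos).le) hQ) 5 (by norm_num)
  have hufin : u.Finite := G.finite_toSet.subset huG
  lift u to Finset (Cube d) using hufin
  have hsub : {x | t < finMax h F x} ⊆ ⋃ Q ∈ u, Metric.closedBall Q.center (5 * (Q.side / 2)) := by
    intro x hx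
    obtain ⟨Q, hQF, hQ⟩ := (Finset.lt_sup_iff).1 (show t < F.sup _ from hx)
    have hxQ : x ∈ Q.toSet := by
      by_contra hxQ
      simp [hxQ] at hQ
    rw [Set.indicator_of_mem hxQ] at hQ
    obtain ⟨R, hR, hQR⟩ := hcov Q (by simp [hG, hQF, hQ])
    exact Set.mem_biUnion hR (hQR (Q.toSet_subset_closedBall hxQ))
  calc t * volume {x | t < finMax h F x}
      ≤ t * ∑ Q ∈ u, volume (Metric.closedBall Q.center (5 * (Q.side / 2))) := by
        gcongr
        exact (measure_mono hsub).trans (measure_biUnion_finset_le _ _)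
    _ = 5 ^ d * ∑ Q ∈ u, t * Q.vol := by
        rw [Finset.mul_sum, Finset.mul_sum]
        refine Finset.sum_congr rfl fun Q _ => ?_
        rw [Q.volume_closedBall_center (by norm_num), ENNReal.ofReal_ofNat]
        ring
    _ ≤ 5 ^ d * ∑ Q ∈ u, 2 * ∫⁻ x in Q.toSet, {x | t < 2 * h x}.indicator h x := by
        gcongr 5 ^ d * ?_
        refine Finset.sum_le_sum fun Q hQ => ?_
        have := huG hQ
        simp only [hG, Finset.coe_filter] at this
        exact mul_vol_le_of_lt_lavg hm ht this.2
    _ = 2 * 5 ^ d * ∫⁻ x in ⋃ Q ∈ u, Q.toSet, {x | t < 2 * h x}.indicator h x := by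
        rw [← Finset.mul_sum, lintegral_biUnion_finset _ (fun Q _ => Q.measurableSet_toSet)]
        · ring
        · intro Q hQ R hR hne
          exact (hdisj hQ hR hne).mono Q.toSet_subset_closedBall R.toSet_subset_closedBall
    _ ≤ 2 * 5 ^ d * ∫⁻ x, {x | t < 2 * h x}.indicator h x := by
        gcongr; exact Measure.restrict_le_self
    _ = _ := by rw [withDensity_apply _ hms, lintegral_indicator hms]

/-- Marcinkiewicz interpolation by hand. The weak type bound leaves the h-measure of {2h > t}
integrated against t^{q-2}, which by the layer cake formula is (q-1)⁻¹ times the integral of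
(2h)^{q-1} h. This is where the factor 1/(q-1) arises. -/
lemma lintegral_finMax_rpow_le {h : (Fin d → ℝ) → ℝ≥0∞} (hm : Measurable h)
    (hfin : ∀ x, h x ≠ ∞) (F : Finset (Cube d)) (hF : ∀ Q ∈ F, lavg h Q ≠ ∞) {q : ℝ} (hq : 1 < q)
    (hq2 : q ≤ 2) :
    ∫⁻ x, finMax h F x ^ q ≤ 8 * 5 ^ d * (ENNReal.ofReal (q - 1))⁻¹ * ∫⁻ x, h x ^ q := by
  have hq1 : 0 < q - 1 := by linarith
  have hanti : Measurable fun t : ℝ => (volume.withDensity h) {x | ENNReal.ofReal t < 2 * h x} :=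
    Antitone.measurable fun s t hst => measure_mono fun x hx =>
      (ENNReal.ofReal_le_ofReal hst).trans_lt hx
  have hlc := lintegral_rpow_eq_lintegral_meas_lt (volume.withDensity h)
    (M := fun x => 2 * h x) (hm.const_mul 2).aemeasurable
    (fun x => ENNReal.mul_ne_top (by simp) (hfin x)) hq1
  rw [lintegral_withDensity_eq_lintegral_mul _ hm ((hm.const_mul 2).pow_const _)] at hlc
  have e1 : ∫⁻ x, (h * fun x => (2 * h x) ^ (q - 1)) x = 2 ^ (q - 1) * ∫⁻ x, h x ^ q := by
    rw [← lintegral_const_mul _ (hm.pow_const q)]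
    refine lintegral_congr fun x => ?_
    have : h x ^ q = h x ^ (q - 1) * h x := by
      rw [show q = (q - 1) + 1 by ring, ENNReal.rpow_add_of_nonneg _ _ hq1.le zero_le_one,
        ENNReal.rpow_one]
      ring_nf
    rw [Pi.mul_apply, ENNReal.mul_rpow_of_nonneg _ _ hq1.le, this]
    ring
  rw [e1] at hlc
  set J := ∫⁻ t in Set.Ioi (0 : ℝ), (volume.withDensity h) {x | ENNReal.ofReal t < 2 * h x} *
    ENNReal.ofReal (t ^ (q - 1 - 1)) with hJ
  have hJle : J ≤ (ENNReal.ofReal (q - 1))⁻¹ * (2 * ∫⁻ x, h x ^ q) := by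
    have h0 : ENNReal.ofReal (q - 1) ≠ 0 := by simpa using hq1
    calc J = (ENNReal.ofReal (q - 1))⁻¹ * (ENNReal.ofReal (q - 1) * J) := by
          rw [← mul_assoc, ENNReal.inv_mul_cancel h0 ENNReal.ofReal_ne_top, one_mul]
      _ ≤ _ := by
          rw [← hlc]
          gcongr
          calc (2 : ℝ≥0∞) ^ (q - 1) ≤ 2 ^ (1 : ℝ) :=
                ENNReal.rpow_le_rpow_of_exponent_le (by norm_num) (by linarith)
            _ = 2 := ENNReal.rpow_one _
  rw [lintegral_rpow_eq_lintegral_meas_lt volume (measurable_finMax h F).aemeasurable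
    (finMax_ne_top hF) (by linarith : 0 < q)]
  have h1 : ∫⁻ t in Set.Ioi (0 : ℝ), volume {x | ENNReal.ofReal t < finMax h F x} *
      ENNReal.ofReal (t ^ (q - 1)) ≤ 2 * 5 ^ d * J := by
    have hm1 : Measurable fun t : ℝ => (volume.withDensity h) {x | ENNReal.ofReal t < 2 * h x} *
        ENNReal.ofReal (t ^ (q - 1 - 1)) := hanti.mul (by fun_prop)
    rw [hJ, ← lintegral_const_mul _ hm1]
    refine setLIntegral_mono' measurableSet_Ioi fun t ht => ?_
    have e : ENNReal.ofReal (t ^ (q - 1)) =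
        ENNReal.ofReal t * ENNReal.ofReal (t ^ (q - 1 - 1)) := by
      rw [← ENNReal.ofReal_mul (le_of_lt ht)]
      congr 1
      rw [show q - 1 = 1 + (q - 1 - 1) by ring, Real.rpow_add ht, Real.rpow_one]
      ring_nf
    rw [e]
    calc _ = (ENNReal.ofReal t * volume {x | ENNReal.ofReal t < finMax h F x}) *
          ENNReal.ofReal (t ^ (q - 1 - 1)) := by ring
      _ ≤ (2 * 5 ^ d * (volume.withDensity h) {x | ENNReal.ofReal t < 2 * h x}) *
          ENNReal.ofReal (t ^ (q - 1 - 1)) := by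
          gcongr ?_ * _
          exact mul_volume_lt_finMax_le hm F ENNReal.ofReal_ne_top
      _ = _ := by rw [mul_assoc]
  calc _ ≤ 2 * (2 * 5 ^ d * ((ENNReal.ofReal (q - 1))⁻¹ * (2 * ∫⁻ x, h x ^ q))) := by
        gcongr
        · rw [← ENNReal.ofReal_ofNat]; exact ENNReal.ofReal_le_ofReal hq2
        · exact h1.trans (by gcongr)
    _ = _ := by ring

lemma lavg_ne_top_of_rpow {h : (Fin d → ℝ) → ℝ≥0∞} {q : ℝ} (hq : 1 ≤ q)
    (hh : ∫⁻ x, h x ^ q ≠ ∞) (Q : Cube d) : lavg h Q ≠ ∞ := by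
  refine lavg_ne_top (ne_top_of_le_ne_top (b := Q.vol + ∫⁻ x, h x ^ q)
    (ENNReal.add_ne_top.2 ⟨Q.vol_ne_top, hh⟩) ?_)
  calc ∫⁻ x in Q.toSet, h x ≤ ∫⁻ x in Q.toSet, (1 + h x ^ q) := by
        refine lintegral_mono fun x => ?_
        rcases le_total (h x) 1 with h1 | h1
        · exact h1.trans le_self_add
        · refine le_add_left ?_
          calc h x = h x ^ (1 : ℝ) := (ENNReal.rpow_one _).symm
            _ ≤ _ := ENNReal.rpow_le_rpow_of_exponent_le h1 hq
    _ = Q.vol + ∫⁻ x in Q.toSet, h x ^ q := by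
        rw [lintegral_add_left measurable_const, lintegral_one, Measure.restrict_apply_univ]; rfl
    _ ≤ _ := by gcongr; exact Measure.restrict_le_self

/-- The Carleson embedding theorem for `1/2`-sparse collections of cubes. -/
theorem IsSparse.tsum_le {S : Set (Cube d)} (hS : IsSparse (1 / 2) S) {h : (Fin d → ℝ) → ℝ≥0∞}
    (hm : Measurable h) (hfin : ∀ x, h x ≠ ∞) {q : ℝ} (hq : 1 < q) (hq2 : q ≤ 2)
    (hh : ∫⁻ x, h x ^ q ≠ ∞) :
    ∑' Q : S, (Q : Cube d).vol * lavg h Q ^ q ≤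
      16 * 5 ^ d * (ENNReal.ofReal (q - 1))⁻¹ * ∫⁻ x, h x ^ q := by
  classical
  obtain ⟨-, E, hE, hdisj⟩ := hS
  rw [ENNReal.tsum_eq_iSup_sum]
  refine iSup_le fun F' => ?_
  set F : Finset (Cube d) := F'.map (Function.Embedding.subtype _) with hF
  have hFS : ∀ Q ∈ F, Q ∈ S := by
    intro Q hQ
    simp only [hF, Finset.mem_map, Function.Embedding.subtype_apply] at hQ
    obtain ⟨R, _, rfl⟩ := hQ
    exact R.2
  have e : ∑ Q ∈ F', (Q : Cube d).vol * lavg h Q ^ q = ∑ Q ∈ F, Q.vol * lavg h Q ^ q := by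
    rw [hF, Finset.sum_map]; rfl
  rw [e]
  -- Sparseness replaces |Q| by 2|E_Q|; on E_Q the average over Q is below the maximal function, and
  -- disjointness merges the integrals.
  calc ∑ Q ∈ F, Q.vol * lavg h Q ^ q ≤ ∑ Q ∈ F, 2 * ∫⁻ x in E Q, finMax h F x ^ q := by
        refine Finset.sum_le_sum fun Q hQ => ?_
        obtain ⟨-, hsub, hvol⟩ := hE Q (hFS Q hQ)
        have h2 : Q.vol ≤ 2 * volume (E Q) := by
          calc Q.vol = 2 * (ENNReal.ofReal (1 / 2) * Q.vol) := by
                rw [← mul_assoc, show (2 : ℝ≥0∞) = ENNReal.ofReal 2 by simp,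
                  ← ENNReal.ofReal_mul (by norm_num)]
                norm_num
            _ ≤ _ := by gcongr
        calc Q.vol * lavg h Q ^ q ≤ 2 * volume (E Q) * lavg h Q ^ q := by gcongr
          _ = 2 * ∫⁻ _x in E Q, lavg h Q ^ q := by rw [setLIntegral_const]; ring
          _ ≤ _ := by
            gcongr 2 * ?_
            refine lintegral_mono_ae ?_
            refine (ae_restrict_iff'₀ (hE Q (hFS Q hQ)).1).2 (Filter.Eventually.of_forall ?_)
            intro x hx
            exact ENNReal.rpow_le_rpow (lavg_le_finMax h hQ (hsub hx)) (by linarith)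
    _ = 2 * ∫⁻ x in ⋃ Q ∈ F, E Q, finMax h F x ^ q := by
        rw [← Finset.mul_sum, lintegral_biUnion_finset₀]
        · intro Q hQ R hR hne
          exact (Set.disjoint_iff_inter_eq_empty.2
            (hdisj Q (hFS Q hQ) R (hFS R hR) hne)).aedisjoint
        · exact fun Q hQ => (hE Q (hFS Q hQ)).1
    _ ≤ 2 * ∫⁻ x, finMax h F x ^ q := by gcongr; exact Measure.restrict_le_self
    _ ≤ 2 * (8 * 5 ^ d * (ENNReal.ofReal (q - 1))⁻¹ * ∫⁻ x, h x ^ q) := by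
        gcongr
        exact lintegral_finMax_rpow_le hm hfin F (fun Q _ => lavg_ne_top_of_rpow hq.le hh Q) hq hq2
    _ = _ := by ring

/-! ### Matrix square roots and their measurability -/

section MatrixSqrt

open scoped MatrixOrder

open scoped Matrix.Norms.L2Operator in
-- Continuity of the square root is a C*-algebra fact, so the operator norm is opened for this
-- statement alone.
lemma continuousOn_cfcSqrt : ContinuousOn (CFC.sqrt : Matrix (Fin n) (Fin n) ℝ → _) {A | 0 ≤ A} :=
  CFC.continuousOn_sqrt

lemma continuousOn_matSqrt :
    ContinuousOn (matSqrt : Matrix (Fin n) (Fin n) ℝ → _) {A | A.PosSemidef} := by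
  have h := continuousOn_cfcSqrt (n := n)
  have e : {A : Matrix (Fin n) (Fin n) ℝ | A.PosSemidef} = _ :=
    Set.ext fun A => Matrix.nonneg_iff_posSemidef.symm
  rw [e]
  exact h

lemma isHermitian_matSqrt (A : Matrix (Fin n) (Fin n) ℝ) : (matSqrt A).IsHermitian :=
  (Matrix.nonneg_iff_posSemidef.1 (CFC.sqrt_nonneg A)).isHermitian

lemma matSqrt_mul_self {A : Matrix (Fin n) (Fin n) ℝ} (hA : A.PosSemidef) :
    matSqrt A * matSqrt A = A :=
  CFC.sqrt_mul_sqrt_self A hA.nonneg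

end MatrixSqrt

lemma isClosed_posSemidef : IsClosed {a : Fin n → Fin n → ℝ | (Matrix.of a).PosSemidef} := by
  simp only [Matrix.posSemidef_iff_dotProduct_mulVec, Set.ofPred_and, Set.ofPred_forall]
  refine IsClosed.inter ?_ (isClosed_iInter fun x => isClosed_le continuous_const ?_)
  · simp only [Matrix.IsHermitian]
    refine isClosed_eq ?_ ?_
    all_goals fun_prop
  · simp only [dotProduct, Matrix.mulVec, Matrix.of_apply]
    fun_prop

/-- The square root is continuous on the closed cone of positive semidefinite matrices; extended by
0 it is a Borel function, and W takes values in the cone almost everywhere. -/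
lemma IsMatrixWeight.aemeasurable_matSqrt {W : (Fin d → ℝ) → Matrix (Fin n) (Fin n) ℝ}
    (hW : IsMatrixWeight W) (i j : Fin n) :
    AEMeasurable (fun x => matSqrt (W x) i j) volume := by
  classical
  set s : Set (Fin n → Fin n → ℝ) := {a | (Matrix.of a).PosSemidef} with hs
  have hc : ContinuousOn (fun a : Fin n → Fin n → ℝ => matSqrt (Matrix.of a) i j) s := by
    have h1 : ContinuousOn (fun a : Fin n → Fin n → ℝ => matSqrt (Matrix.of a)) s :=
      continuousOn_matSqrt.comp (f := fun a : Fin n → Fin n → ℝ => Matrix.of a)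
        (by fun_prop) fun a ha => ha
    exact (continuous_id.matrix_elem i j).comp_continuousOn h1
  have hm : Measurable (s.piecewise (fun a => matSqrt (Matrix.of a) i j) fun _ => 0) :=
    hc.measurable_piecewise continuousOn_const isClosed_posSemidef.measurableSet
  have hWm : AEMeasurable (fun x => (fun i j => W x i j : Fin n → Fin n → ℝ)) volume :=
    aemeasurable_pi_lambda _ fun i => aemeasurable_pi_lambda _ fun j =>
      (hW.locallyIntegrable i j).aestronglyMeasurable.aemeasurable
  refine (hm.comp_aemeasurable hWm).congr ?_
  filter_upwards [hW.posSemidef] with x hx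
  exact Set.piecewise_eq_of_mem _ _ _ (show (fun i j => W x i j) ∈ s from hx)

lemma IsMatrixWeight.aestronglyMeasurable_sqrtMul {W : (Fin d → ℝ) → Matrix (Fin n) (Fin n) ℝ}
    (hW : IsMatrixWeight W) {f : (Fin d → ℝ) → EuclideanSpace ℝ (Fin n)}
    (hf : AEStronglyMeasurable f volume) : AEStronglyMeasurable (sqrtMul W f) volume := by
  have h : AEMeasurable (fun x => (fun i => sqrtMul W f x i : Fin n → ℝ)) volume := by
    refine aemeasurable_pi_lambda _ fun i => ?_
    have : (fun x => sqrtMul W f x i) = fun x => ∑ j, matSqrt (W x) i j * f x j := rfl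
    rw [this]
    refine Finset.aemeasurable_fun_sum _ fun j _ => (hW.aemeasurable_matSqrt i j).mul ?_
    exact ((EuclideanSpace.proj (𝕜 := ℝ) j).continuous.measurable).comp_aemeasurable
      hf.aemeasurable
  exact ((PiLp.continuous_toLp 2 _).measurable.comp_aemeasurable h).aestronglyMeasurable

lemma inner_toEuclideanCLM_comm {A : Matrix (Fin n) (Fin n) ℝ} (hA : A.IsHermitian)
    (x y : EuclideanSpace ℝ (Fin n)) :
    inner ℝ (Matrix.toEuclideanCLM (𝕜 := ℝ) A x) y =
      inner ℝ x (Matrix.toEuclideanCLM (𝕜 := ℝ) A y) := by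
  have h : ContinuousLinearMap.adjoint (Matrix.toEuclideanCLM (𝕜 := ℝ) A) =
      Matrix.toEuclideanCLM (𝕜 := ℝ) A := by
    rw [← ContinuousLinearMap.star_eq_adjoint, ← map_star]
    congr 1
  rw [← ContinuousLinearMap.adjoint_inner_right, h]

lemma norm_matSqrt_sq {A : Matrix (Fin n) (Fin n) ℝ} (hA : A.PosSemidef)
    (x : EuclideanSpace ℝ (Fin n)) :
    ‖Matrix.toEuclideanCLM (𝕜 := ℝ) (matSqrt A) x‖ ^ 2 =
      inner ℝ (Matrix.toEuclideanCLM (𝕜 := ℝ) A x) x := by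
  rw [← real_inner_self_eq_norm_sq, ← inner_toEuclideanCLM_comm (isHermitian_matSqrt A)]
  conv_rhs => rw [← matSqrt_mul_self hA, map_mul]
  rfl

lemma inner_toEuclideanCLM_eq_sum (A : Matrix (Fin n) (Fin n) ℝ)
    (x : EuclideanSpace ℝ (Fin n)) :
    inner ℝ (Matrix.toEuclideanCLM (𝕜 := ℝ) A x) x = ∑ i, ∑ j, x i * x j * A i j := by
  rw [real_inner_comm, Matrix.inner_toEuclideanCLM]
  simp only [dotProduct, Matrix.mulVec, Finset.mul_sum]
  exact Finset.sum_congr rfl fun i _ => Finset.sum_congr rfl fun j _ => by ring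

/-! ### Directional weights -/

/-- The scalar weight `⟨W ξ, ξ⟩`. -/
def dirWeight (W : (Fin d → ℝ) → Matrix (Fin n) (Fin n) ℝ) (ξ : EuclideanSpace ℝ (Fin n))
    (x : Fin d → ℝ) : ℝ :=
  inner ℝ (Matrix.toEuclideanCLM (𝕜 := ℝ) (W x) ξ) ξ

namespace IsMatrixWeight

variable {W : (Fin d → ℝ) → Matrix (Fin n) (Fin n) ℝ}

lemma enorm_sqrt_eq (hW : IsMatrixWeight W) (ξ : EuclideanSpace ℝ (Fin n)) :
    ∀ᵐ x, ‖Matrix.toEuclideanCLM (𝕜 := ℝ) (matSqrt (W x)) ξ‖ₑ =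
      ENNReal.ofReal (dirWeight W ξ x) ^ (1 / 2 : ℝ) := by
  filter_upwards [hW.posSemidef] with x hx
  rw [dirWeight, ← norm_matSqrt_sq hx, ENNReal.ofReal_pow (norm_nonneg _), ofReal_norm,
    ← ENNReal.rpow_natCast, ← ENNReal.rpow_mul]
  norm_num

lemma dirWeight_nonneg (hW : IsMatrixWeight W) (ξ : EuclideanSpace ℝ (Fin n)) :
    0 ≤ᵐ[volume] dirWeight W ξ := by
  filter_upwards [hW.posSemidef] with x hx
  rw [dirWeight, ← norm_matSqrt_sq hx]
  exact sq_nonneg _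

lemma dirWeight_eq_sum (ξ : EuclideanSpace ℝ (Fin n)) :
    dirWeight W ξ = fun x => ∑ i, ∑ j, ξ i * ξ j * W x i j := by
  ext x
  exact inner_toEuclideanCLM_eq_sum _ _

lemma integrableOn (hW : IsMatrixWeight W) (i j : Fin n) (Q : Cube d) :
    IntegrableOn (fun x => W x i j) Q.toSet volume :=
  ((hW.locallyIntegrable i j).integrableOn_isCompact
    (isCompact_closedBall Q.center (Q.side / 2))).mono_set Q.toSet_subset_closedBall

lemma locallyIntegrable_dirWeight (hW : IsMatrixWeight W) (ξ : EuclideanSpace ℝ (Fin n)) :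
    LocallyIntegrable (dirWeight W ξ) volume := by
  rw [dirWeight_eq_sum]
  refine locallyIntegrable_finsetSum _ fun i _ => locallyIntegrable_finsetSum _ fun j _ => ?_
  exact (hW.locallyIntegrable i j).smul (ξ i * ξ j)

lemma inner_matAvg (hW : IsMatrixWeight W) (Q : Cube d) (ξ : EuclideanSpace ℝ (Fin n)) :
    inner ℝ (Matrix.toEuclideanCLM (𝕜 := ℝ) (matAvg W Q) ξ) ξ =
      ⨍ x in Q.toSet, dirWeight W ξ x := by
  rw [inner_toEuclideanCLM_eq_sum, dirWeight_eq_sum, setAverage_eq, integral_finsetSum]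
  · rw [Finset.smul_sum]
    refine Finset.sum_congr rfl fun i _ => ?_
    rw [integral_finsetSum]
    · rw [Finset.smul_sum]
      refine Finset.sum_congr rfl fun j _ => ?_
      rw [integral_const_mul, matAvg, Matrix.of_apply, setAverage_eq, smul_eq_mul, smul_eq_mul]
      ring
    · exact fun j _ => (hW.integrableOn i j Q).const_mul _
  · exact fun i _ => integrable_finsetSum _ fun j _ => (hW.integrableOn i j Q).const_mul _

lemma posSemidef_matAvg (hW : IsMatrixWeight W) (Q : Cube d) : (matAvg W Q).PosSemidef := by
  refine Matrix.PosSemidef.of_dotProduct_mulVec_nonneg ?_ fun x => ?_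
  · ext i j
    simp only [Matrix.conjTranspose_apply, matAvg, Matrix.of_apply, star_trivial]
    rw [setAverage_eq, setAverage_eq]
    congr 1
    refine integral_congr_ae (ae_restrict_of_ae ?_)
    filter_upwards [hW.posSemidef] with y hy
    simpa using hy.isHermitian.apply i j
  · have h := hW.inner_matAvg Q (WithLp.toLp 2 x)
    rw [real_inner_comm, Matrix.inner_toEuclideanCLM] at h
    rw [star_trivial]
    refine le_of_le_of_eq ?_ h.symm
    rw [setAverage_eq]
    refine smul_nonneg (by positivity) (integral_nonneg_of_ae (ae_restrict_of_ae ?_))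
    exact hW.dirWeight_nonneg _

/-- Both sides are ⟨W_Q ξ, ξ⟩. Through this identity the scalar reverse Hölder inequality yields
bounds by |W_Q^{1/2}ξ|. -/
lemma lavg_dirWeight (hW : IsMatrixWeight W) (Q : Cube d) (ξ : EuclideanSpace ℝ (Fin n)) :
    lavg (fun x => ENNReal.ofReal (dirWeight W ξ x)) Q =
      ‖Matrix.toEuclideanCLM (𝕜 := ℝ) (matSqrt (matAvg W Q)) ξ‖ₑ ^ 2 := by
  rw [← ofReal_norm, ← ENNReal.ofReal_pow (norm_nonneg _), norm_matSqrt_sq (hW.posSemidef_matAvg Q),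
    hW.inner_matAvg, lavg, setAverage_eq,
    ← ofReal_integral_eq_lintegral_ofReal _ (ae_restrict_of_ae (hW.dirWeight_nonneg ξ)),
    smul_eq_mul, ENNReal.ofReal_mul (by positivity), ENNReal.div_eq_inv_mul]
  · congr 1
    change Q.vol⁻¹ = ENNReal.ofReal Q.vol.toReal⁻¹
    rw [ENNReal.ofReal_inv_of_pos (ENNReal.toReal_pos Q.vol_ne_zero Q.vol_ne_top),
      ENNReal.ofReal_toReal Q.vol_ne_top]
  · exact ((hW.locallyIntegrable_dirWeight ξ).integrableOn_isCompact
      (isCompact_closedBall Q.center (Q.side / 2))).mono_set Q.toSet_subset_closedBall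

lemma ainfConst_dirWeight_le {ξ : EuclideanSpace ℝ (Fin n)} (hξ : ‖ξ‖ = 1) :
    ainfConst (dirWeight W ξ) ≤ matAinfConst W :=
  le_iSup₂ (f := fun (ξ : EuclideanSpace ℝ (Fin n)) (_ : ‖ξ‖ = 1) => ainfConst (dirWeight W ξ)) ξ hξ

/-- Either `[W]_{A_∞} ≥ 1` or all the averages of `W` vanish. -/
lemma matSqrt_matAvg_eq_zero (hW : IsMatrixWeight W) (h : matAinfConst W < 1) (Q : Cube d) :
    Matrix.toEuclideanCLM (𝕜 := ℝ) (matSqrt (matAvg W Q)) = 0 := by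
  have key : ∀ ξ : EuclideanSpace ℝ (Fin n), ‖ξ‖ = 1 →
      Matrix.toEuclideanCLM (𝕜 := ℝ) (matSqrt (matAvg W Q)) ξ = 0 := by
    intro ξ hξ
    have hl := hW.lavg_dirWeight Q ξ
    by_contra hne
    set I := ∫⁻ x in Q.toSet, ENNReal.ofReal (dirWeight W ξ x) with hI
    have hI0 : I ≠ 0 := by
      intro h0
      rw [lavg, ← hI, h0, ENNReal.zero_div] at hl
      exact hne (by simpa using hl.symm)
    have hItop : I ≠ ∞ := by
      rw [hI, ← lavg_mul_vol, hl]
      exact ENNReal.mul_ne_top (by simp) Q.vol_ne_top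
    have h1 := (le_iSup (fun Q : Cube d => (∫⁻ x in Q.toSet,
      maximalFn (Q.toSet.indicator (dirWeight W ξ)) x) /
        ∫⁻ x in Q.toSet, ENNReal.ofReal (dirWeight W ξ x)) Q).trans (ainfConst_dirWeight_le hξ)
    -- At each point of Q the maximal function is at least the average over Q itself, so a cube of
    -- positive mass forces the constant to be at least 1.
    have h2 : I ≤ ∫⁻ x in Q.toSet, maximalFn (Q.toSet.indicator (dirWeight W ξ)) x := by
      calc I = ∫⁻ _x in Q.toSet, lavg (fun x => ENNReal.ofReal (dirWeight W ξ x)) Q := by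
            rw [setLIntegral_const, hI, ← lavg_mul_vol]; rfl
        _ ≤ _ := by
            refine setLIntegral_mono' Q.measurableSet_toSet fun x hx => ?_
            rw [← normAvg_one_indicator (hW.dirWeight_nonneg ξ) (le_refl Q.toSet)]
            exact le_iSup₂ (f := fun (R : Cube d) (_ : x ∈ R.toSet) =>
              normAvg 1 R (Q.toSet.indicator (dirWeight W ξ))) Q hx
    have h3 : 1 ≤ matAinfConst W := by
      refine le_trans ?_ h1
      rw [ENNReal.le_div_iff_mul_le (Or.inl hI0) (Or.inl hItop), one_mul]
      exact h2
    exact absurd h h3.not_gt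
  refine ContinuousLinearMap.coe_injective ((EuclideanSpace.basisFun (Fin n) ℝ).toBasis.ext
    fun i => ?_)
  simpa using key (EuclideanSpace.basisFun (Fin n) ℝ i) (OrthonormalBasis.norm_eq_one _ i)

end IsMatrixWeight

/-! ### Components and products of convex bodies -/

lemma lintegral_mul_mul_rpow_le {α : Type*} [MeasurableSpace α] {μ : Measure α}
    {a b c : α → ℝ≥0∞} (ha : AEMeasurable a μ) (hb : AEMeasurable b μ) (hc : AEMeasurable c μ)
    {p q r : ℝ} (hp : 0 ≤ p) (hq : 0 ≤ q) (hr : 0 ≤ r) (h : p + q + r = 1) :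
    ∫⁻ x, a x ^ p * b x ^ q * c x ^ r ∂μ ≤
      (∫⁻ x, a x ∂μ) ^ p * (∫⁻ x, b x ∂μ) ^ q * (∫⁻ x, c x ∂μ) ^ r := by
  have := ENNReal.lintegral_prod_norm_pow_le (μ := μ) (Finset.univ : Finset (Fin 3))
    (f := ![a, b, c]) (p := ![p, q, r])
    (fun i _ => by fin_cases i <;> simpa) (by simpa [Fin.sum_univ_three] using h)
    (fun i _ => by fin_cases i <;> simpa)
  simpa [Fin.prod_univ_three] using this

lemma tsum_mul_le_sqrt_mul_sqrt {ι : Type*} (a b : ι → ℝ≥0∞) :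
    ∑' i, a i * b i ≤ (∑' i, a i ^ 2) ^ (1 / 2 : ℝ) * (∑' i, b i ^ 2) ^ (1 / 2 : ℝ) := by
  rw [ENNReal.tsum_eq_iSup_sum]
  refine iSup_le fun F => (ENNReal.inner_le_Lp_mul_Lq F a b Real.HolderConjugate.two_two).trans ?_
  simp only [ENNReal.rpow_ofNat]
  gcongr <;> exact ENNReal.sum_le_tsum F

lemma enorm_inner_setAverage_le {f : (Fin d → ℝ) → EuclideanSpace ℝ (Fin n)}
    {φ : (Fin d → ℝ) → ℝ} (Q : Cube d) (ξ : EuclideanSpace ℝ (Fin n)) :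
    ‖inner ℝ (⨍ x in Q.toSet, φ x • f x) ξ‖ₑ ≤
      Q.vol⁻¹ * ∫⁻ x in Q.toSet, ‖φ x‖ₑ * ‖inner ℝ (f x) ξ‖ₑ := by
  by_cases hint : Integrable (fun x => φ x • f x) (volume.restrict Q.toSet)
  · rw [setAverage_eq, real_inner_smul_left, real_inner_comm, ← integral_inner hint, enorm_mul]
    have hv : ‖(volume.real Q.toSet)⁻¹‖ₑ = Q.vol⁻¹ := by
      change ‖Q.vol.toReal⁻¹‖ₑ = Q.vol⁻¹
      have hpos := ENNReal.toReal_pos Q.vol_ne_zero Q.vol_ne_top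
      rw [Real.enorm_of_nonneg (by positivity), ENNReal.ofReal_inv_of_pos hpos,
        ENNReal.ofReal_toReal Q.vol_ne_top]
    rw [hv]
    gcongr
    refine (enorm_integral_le_lintegral_enorm _).trans (lintegral_mono fun x => ?_)
    rw [inner_smul_right, enorm_mul, real_inner_comm]
  · rw [setAverage_eq, integral_undef hint, smul_zero, inner_zero_left, enorm_zero]
    exact zero_le

lemma conjExponent_ofReal {ε : ℝ} (hε : 0 < ε) :
    ENNReal.conjExponent (ENNReal.ofReal (1 + ε)) = ENNReal.ofReal ((1 + ε) / ε) := by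
  rw [ENNReal.conjExponent, ← ENNReal.ofReal_one, ← ENNReal.ofReal_sub _ zero_le_one,
    ← ENNReal.ofReal_inv_of_pos (by linarith), ← ENNReal.ofReal_add zero_le_one (by
      rw [add_sub_cancel_left]; positivity)]
  congr 1
  rw [add_sub_cancel_left]
  field_simp
  ring

lemma lintegral_rpow_le_of_normAvg_le {φ : (Fin d → ℝ) → ℝ} {Q : Cube d} {ε : ℝ} (hε : 0 < ε)
    (h : normAvg (ENNReal.conjExponent (ENNReal.ofReal (1 + ε))) Q φ ≤ 1) :
    (∫⁻ x in Q.toSet, ‖φ x‖ₑ ^ ((1 + ε) / ε)) ^ (ε / (1 + ε)) ≤ Q.vol ^ (ε / (1 + ε)) := by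
  have hpos : 0 < (1 + ε) / ε := by positivity
  rw [conjExponent_ofReal hε, normAvg, eLpNorm_indicator_eq_eLpNorm_restrict
    Q.measurableSet_toSet, eLpNorm_eq_lintegral_rpow_enorm_toReal (by simpa using hpos)
    ENNReal.ofReal_ne_top, ENNReal.toReal_ofReal hpos.le, one_div_div] at h
  rwa [ENNReal.div_le_iff, one_mul] at h
  · simp [ENNReal.rpow_eq_zero_iff, Q.vol_ne_zero, Q.vol_ne_top]
  · exact ENNReal.rpow_ne_top_of_nonneg (by positivity) Q.vol_ne_top

namespace IsMatrixWeight

variable {W : (Fin d → ℝ) → Matrix (Fin n) (Fin n) ℝ}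

/-- W^{1/2} is symmetric, so it can be moved onto ξ, where it becomes the scalar weight;
Cauchy-Schwarz does the rest. -/
lemma enorm_inner_sqrtMul_le (hW : IsMatrixWeight W)
    (f : (Fin d → ℝ) → EuclideanSpace ℝ (Fin n)) (ξ : EuclideanSpace ℝ (Fin n)) :
    ∀ᵐ x, ‖inner ℝ (sqrtMul W f x) ξ‖ₑ ≤
      ENNReal.ofReal (dirWeight W ξ x) ^ (1 / 2 : ℝ) * ‖f x‖ₑ := by
  filter_upwards [hW.enorm_sqrt_eq ξ] with x hx
  rw [← hx, sqrtMul, inner_toEuclideanCLM_comm (isHermitian_matSqrt _), mul_comm,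
    ← ofReal_norm, ← ofReal_norm, ← ofReal_norm, ← ENNReal.ofReal_mul (norm_nonneg _)]
  exact ENNReal.ofReal_le_ofReal (norm_inner_le_norm _ _)

/-- The components of the vectors in the convex body of `W^{1/2} f`, under a reverse Hölder
inequality for the corresponding directional weight. -/
lemma enorm_inner_convexBody_le (hW : IsMatrixWeight W)
    {f : (Fin d → ℝ) → EuclideanSpace ℝ (Fin n)} (hf : AEStronglyMeasurable f volume) {Q : Cube d}
    {ξ : EuclideanSpace ℝ (Fin n)} {ε δ s : ℝ} (hε : 0 < ε) (hδ : 0 < δ) (hs : 0 < s)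
    (hsum : ε / (1 + ε) + 1 / (2 * (1 + δ)) + 1 / s = 1)
    (hRH : ∫⁻ x in Q.toSet, ENNReal.ofReal (dirWeight W ξ x) ^ (1 + δ) ≤
      2 * lavg (fun x => ENNReal.ofReal (dirWeight W ξ x)) Q ^ (1 + δ) * Q.vol)
    {a : EuclideanSpace ℝ (Fin n)}
    (ha : a ∈ convexBody (ENNReal.ofReal (1 + ε)) Q (sqrtMul W f)) :
    ‖inner ℝ a ξ‖ₑ ≤ 2 * ‖Matrix.toEuclideanCLM (𝕜 := ℝ) (matSqrt (matAvg W Q)) ξ‖ₑ *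
      lavg (fun x => ‖f x‖ₑ ^ s) Q ^ (1 / s) := by
  obtain ⟨φ, hφm, hφ, rfl⟩ := ha
  refine (enorm_inner_setAverage_le Q ξ).trans ?_
  set u : (Fin d → ℝ) → ℝ≥0∞ := fun x => ENNReal.ofReal (dirWeight W ξ x) with hu
  have hum : AEMeasurable u (volume.restrict Q.toSet) :=
    (hW.locallyIntegrable_dirWeight ξ).aestronglyMeasurable.aemeasurable.ennreal_ofReal.restrict
  set B := ‖Matrix.toEuclideanCLM (𝕜 := ℝ) (matSqrt (matAvg W Q)) ξ‖ₑ with hB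
  set X := lavg (fun x => ‖f x‖ₑ ^ s) Q with hX
  set v := Q.vol with hv
  set β := 1 / (2 * (1 + δ)) with hβ
  have hβ0 : 0 ≤ β := by positivity
  have hε0 : 0 ≤ ε / (1 + ε) := by positivity
  have hs0 : 0 ≤ 1 / s := by positivity
  have h1 : ∫⁻ x in Q.toSet, ‖φ x‖ₑ * ‖inner ℝ (sqrtMul W f x) ξ‖ₑ ≤
      ∫⁻ x in Q.toSet, (‖φ x‖ₑ ^ ((1 + ε) / ε)) ^ (ε / (1 + ε)) * (u x ^ (1 + δ)) ^ β *
        (‖f x‖ₑ ^ s) ^ (1 / s) := by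
    refine lintegral_mono_ae (ae_restrict_of_ae ?_)
    filter_upwards [hW.enorm_inner_sqrtMul_le f ξ] with x hx
    rw [← ENNReal.rpow_mul, ← ENNReal.rpow_mul, ← ENNReal.rpow_mul,
      show (1 + ε) / ε * (ε / (1 + ε)) = 1 by field_simp,
      show (1 + δ) * β = 1 / 2 by rw [hβ]; field_simp,
      show s * (1 / s) = 1 by field_simp, ENNReal.rpow_one, ENNReal.rpow_one, mul_assoc]
    gcongr
  have h2 := h1.trans (lintegral_mul_mul_rpow_le (hφm.enorm.pow_const _) (hum.pow_const _)
    (hf.enorm.restrict.pow_const _) hε0 hβ0 hs0 hsum)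
  have h3 : (∫⁻ x in Q.toSet, u x ^ (1 + δ)) ^ β ≤ 2 * B * v ^ β := by
    have hl : lavg u Q = B ^ 2 := hW.lavg_dirWeight Q ξ
    rw [hl] at hRH
    calc (∫⁻ x in Q.toSet, u x ^ (1 + δ)) ^ β ≤ (2 * (B ^ 2) ^ (1 + δ) * v) ^ β := by gcongr
      _ = 2 ^ β * B * v ^ β := by
        rw [ENNReal.mul_rpow_of_nonneg _ _ hβ0, ENNReal.mul_rpow_of_nonneg _ _ hβ0,
          ← ENNReal.rpow_natCast, ← ENNReal.rpow_mul, ← ENNReal.rpow_mul,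
          show ((2 : ℕ) : ℝ) * ((1 + δ) * β) = 1 by rw [hβ]; push_cast; field_simp, ENNReal.rpow_one]
      _ ≤ 2 ^ (1 : ℝ) * B * v ^ β := by
        gcongr
        · norm_num
        · rw [hβ, div_le_one (by positivity)]; linarith
      _ = _ := by rw [ENNReal.rpow_one]
  have h4 : (∫⁻ x in Q.toSet, ‖f x‖ₑ ^ s) ^ (1 / s) = X ^ (1 / s) * v ^ (1 / s) := by
    rw [← ENNReal.mul_rpow_of_nonneg _ _ hs0, hX, hv, lavg_mul_vol]
  rw [h4] at h2
  -- Since the Hölder exponents add up to 1, the powers of |Q| cancel against the normalization of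
  -- the average.
  have hvv : v ^ (ε / (1 + ε)) * v ^ β * v ^ (1 / s) = v := by
    rw [← ENNReal.rpow_add_of_nonneg _ _ hε0 hβ0,
      ← ENNReal.rpow_add_of_nonneg _ _ (by positivity) hs0, hsum, ENNReal.rpow_one]
  calc v⁻¹ * ∫⁻ x in Q.toSet, ‖φ x‖ₑ * ‖inner ℝ (sqrtMul W f x) ξ‖ₑ
      ≤ v⁻¹ * (v ^ (ε / (1 + ε)) * (2 * B * v ^ β) * (X ^ (1 / s) * v ^ (1 / s))) := by
        gcongr
        refine h2.trans ?_
        gcongr ?_ * ?_ * _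
        exact lintegral_rpow_le_of_normAvg_le hε hφ
    _ = v⁻¹ * (v ^ (ε / (1 + ε)) * v ^ β * v ^ (1 / s)) * (2 * B * X ^ (1 / s)) := by ring
    _ = _ := by rw [hvv, ENNReal.inv_mul_cancel Q.vol_ne_zero Q.vol_ne_top, one_mul]

end IsMatrixWeight

/-- Two families of vectors whose components are controlled by `√W_Q` and `√V_Q`. -/
lemma enorm_inner_le_of_enorm_inner_le {S T : Matrix (Fin n) (Fin n) ℝ} (hS : S.IsHermitian)
    (hT : T.IsHermitian) {a b : EuclideanSpace ℝ (Fin n)} {X Y : ℝ≥0∞}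
    (ha : ∀ ξ, ‖ξ‖ = 1 → ‖inner ℝ a ξ‖ₑ ≤ X * ‖Matrix.toEuclideanCLM (𝕜 := ℝ) T ξ‖ₑ)
    (hb : ∀ ξ, ‖ξ‖ = 1 → ‖inner ℝ b ξ‖ₑ ≤ Y * ‖Matrix.toEuclideanCLM (𝕜 := ℝ) S ξ‖ₑ) :
    ‖inner ℝ a b‖ₑ ≤ n ^ 2 * (X * Y * ‖Matrix.toEuclideanCLM (𝕜 := ℝ) (S * T)‖ₑ) := by
  set e := hT.eigenvectorBasis with he
  set u := hS.eigenvectorBasis with hu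
  have hTe : ∀ i, Matrix.toEuclideanCLM (𝕜 := ℝ) T (e i) = hT.eigenvalues i • e i := by
    intro i
    ext j
    simpa using congrFun (hT.mulVec_eigenvectorBasis i) j
  have hSu : ∀ i, Matrix.toEuclideanCLM (𝕜 := ℝ) S (u i) = hS.eigenvalues i • u i := by
    intro i
    ext j
    simpa using congrFun (hS.mulVec_eigenvectorBasis i) j
  have hexp : inner ℝ a b = ∑ i, ∑ j, inner ℝ a (e i) * inner ℝ b (u j) * inner ℝ (e i) (u j) := by
    rw [← e.sum_inner_mul_inner]
    refine Finset.sum_congr rfl fun i _ => ?_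
    rw [← u.sum_inner_mul_inner (e i) b, Finset.mul_sum]
    refine Finset.sum_congr rfl fun j _ => ?_
    rw [real_inner_comm b]; ring
  have hij : ∀ i j, ‖inner ℝ a (e i) * inner ℝ b (u j) * inner ℝ (e i) (u j)‖ₑ ≤
      X * Y * ‖Matrix.toEuclideanCLM (𝕜 := ℝ) (S * T)‖ₑ := by
    intro i j
    -- The componentwise bounds supply exactly the eigenvalue factors that turn ⟨e_i,u_j⟩ into a
    -- matrix entry of ST. No inverse is taken, so singular averages are allowed.
    have h1 : inner ℝ (Matrix.toEuclideanCLM (𝕜 := ℝ) (S * T) (e i)) (u j) =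
        hT.eigenvalues i * hS.eigenvalues j * inner ℝ (e i) (u j) := by
      rw [map_mul]
      change inner ℝ (Matrix.toEuclideanCLM (𝕜 := ℝ) S (Matrix.toEuclideanCLM (𝕜 := ℝ) T (e i)))
        (u j) = _
      rw [inner_toEuclideanCLM_comm hS, hTe, hSu, real_inner_smul_left, real_inner_smul_right]
      ring
    have hn1 : ∀ i, ‖e i‖ₑ = 1 := fun i => by rw [← ofReal_norm, e.norm_eq_one]; simp
    have hn2 : ∀ i, ‖u i‖ₑ = 1 := fun i => by rw [← ofReal_norm, u.norm_eq_one]; simp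
    have h2 : ‖hT.eigenvalues i‖ₑ * ‖hS.eigenvalues j‖ₑ * ‖inner ℝ (e i) (u j)‖ₑ ≤
        ‖Matrix.toEuclideanCLM (𝕜 := ℝ) (S * T)‖ₑ := by
      rw [← enorm_mul, ← enorm_mul, ← h1, ← ofReal_norm, ← ofReal_norm]
      refine ENNReal.ofReal_le_ofReal ((norm_inner_le_norm _ _).trans ?_)
      rw [u.norm_eq_one, mul_one]
      refine (ContinuousLinearMap.le_opNorm _ _).trans ?_
      rw [e.norm_eq_one, mul_one]
    have h3 := ha (e i) (e.norm_eq_one i)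
    have h4 := hb (u j) (u.norm_eq_one j)
    rw [hTe, enorm_smul, hn1, mul_one] at h3
    rw [hSu, enorm_smul, hn2, mul_one] at h4
    rw [enorm_mul, enorm_mul]
    calc _ ≤ (X * ‖hT.eigenvalues i‖ₑ) * (Y * ‖hS.eigenvalues j‖ₑ) * ‖inner ℝ (e i) (u j)‖ₑ := by
          gcongr
      _ = X * Y * (‖hT.eigenvalues i‖ₑ * ‖hS.eigenvalues j‖ₑ * ‖inner ℝ (e i) (u j)‖ₑ) := by ring
      _ ≤ _ := by gcongr
  rw [hexp]
  refine (enorm_sum_le _ _).trans ?_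
  calc _ ≤ ∑ _i : Fin n, ∑ _j : Fin n, X * Y * ‖Matrix.toEuclideanCLM (𝕜 := ℝ) (S * T)‖ₑ :=
        Finset.sum_le_sum fun i _ => (enorm_sum_le _ _).trans (Finset.sum_le_sum fun j _ => hij i j)
    _ = _ := by simp; ring

/-! ### Choice of exponents and the bound for one function -/

/-- The quantity q = 2/(1+ε) - 1/(1+δ) is the Carleson exponent. The gain δ/2 from the weight
outweighs the loss 2ε from the convex bodies, leaving at least δ/6. -/
lemma exponent_bounds {ε δ : ℝ} (hε : 0 < ε) (hδ : δ ≤ 1) (hεδ : 6 * ε ≤ δ) :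
    δ / 6 ≤ 2 / (1 + ε) - 1 / (1 + δ) - 1 ∧ 2 / (1 + ε) - 1 / (1 + δ) ≤ 2 := by
  have h1 : 2 - 2 * ε ≤ 2 / (1 + ε) := by
    rw [le_div_iff₀ (by linarith)]; nlinarith
  have h2 : 1 / (1 + δ) ≤ 1 - δ / 2 := by
    rw [div_le_iff₀ (by linarith)]; nlinarith
  have h3 : 2 / (1 + ε) ≤ 2 := by
    rw [div_le_iff₀ (by linarith)]; linarith
  have h4 : 0 < 1 / (1 + δ) := by
    have : 0 < 1 + δ := by linarith
    positivity
  constructor <;> linarith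

/-- The Carleson embedding theorem for `L^s` averages of `L^2` functions. -/
lemma IsSparse.tsum_sq_le {S : Set (Cube d)} (hS : IsSparse (1 / 2) S)
    {f : (Fin d → ℝ) → EuclideanSpace ℝ (Fin n)} (hf : MemLp f 2 volume) {q : ℝ} (hq : 1 < q)
    (hq2 : q ≤ 2) :
    ∑' Q : S, (Q : Cube d).vol * (lavg (fun x => ‖f x‖ₑ ^ (2 / q)) Q ^ (1 / (2 / q))) ^ 2 ≤
      16 * 5 ^ d * (ENNReal.ofReal (q - 1))⁻¹ * eLpNorm f 2 volume ^ 2 := by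
  have hq0 : 0 < q := by linarith
  set g := hf.1.mk f with hg
  have hfg : f =ᵐ[volume] g := hf.1.ae_eq_mk
  have hpow : ∀ x, (‖g x‖ₑ ^ (2 / q)) ^ q = ‖g x‖ₑ ^ (2 : ℝ) := fun x => by
    rw [← ENNReal.rpow_mul, div_mul_cancel₀ _ hq0.ne']
  have hint : ∫⁻ x, (‖g x‖ₑ ^ (2 / q)) ^ q = eLpNorm f 2 volume ^ 2 := by
    simp only [hpow]
    rw [eLpNorm_congr_ae hfg, eLpNorm_eq_lintegral_rpow_enorm_toReal (by simp) (by simp),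
      ← ENNReal.rpow_natCast, ← ENNReal.rpow_mul]
    norm_num
  have h := hS.tsum_le (h := fun x => ‖g x‖ₑ ^ (2 / q))
    (hf.1.stronglyMeasurable_mk.measurable.enorm.pow_const _)
    (fun x => ENNReal.rpow_ne_top_of_nonneg (by positivity) enorm_ne_top) hq hq2
    (by rw [hint]; exact ENNReal.pow_ne_top hf.2.ne)
  rw [hint] at h
  refine le_trans (le_of_eq (tsum_congr fun Q => ?_)) h
  have hl : lavg (fun x => ‖f x‖ₑ ^ (2 / q)) Q = lavg (fun x => ‖g x‖ₑ ^ (2 / q)) Q := by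
    rw [lavg, lavg]
    congr 1
    exact lintegral_congr_ae (ae_restrict_of_ae (hfg.mono fun x hx => by simp only [hx]))
  rw [hl, ← ENNReal.rpow_natCast, ← ENNReal.rpow_mul, one_div_div]
  congr 2
  push_cast; field_simp

lemma memLp_of_inner {α : Type*} [MeasurableSpace α] {μ : Measure α} {p : ℝ≥0∞}
    {F : α → EuclideanSpace ℝ (Fin n)} (hF : AEStronglyMeasurable F μ)
    (h : ∀ ξ : EuclideanSpace ℝ (Fin n), ‖ξ‖ = 1 → MemLp (fun x => inner ℝ (F x) ξ) p μ) :
    MemLp F p μ := by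
  set b := EuclideanSpace.basisFun (Fin n) ℝ
  refine (memLp_finsetSum (Finset.univ : Finset (Fin n))
    fun i _ => (h (b i) (b.norm_eq_one i)).norm).mono' hF (Filter.Eventually.of_forall fun x => ?_)
  conv_lhs => rw [← b.sum_repr' (F x)]
  refine (norm_sum_le _ _).trans (Finset.sum_le_sum fun i _ => ?_)
  rw [norm_smul, b.norm_eq_one, mul_one, real_inner_comm]

lemma rpow_mul_rpow_le_add (x y : ℝ≥0∞) {a b : ℝ} (ha : 0 ≤ a) (hb : 0 ≤ b) (h : a + b = 1) :
    x ^ a * y ^ b ≤ x + y := by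
  calc x ^ a * y ^ b ≤ (x + y) ^ a * (x + y) ^ b := by
        gcongr
        · exact le_self_add
        · exact le_add_self
    _ = x + y := by rw [← ENNReal.rpow_add_of_nonneg _ _ ha hb, h, ENNReal.rpow_one]

lemma rpow_le_one_add_sq (x : ℝ≥0∞) {s : ℝ} (hs : 0 ≤ s) (hs2 : s ≤ 2) :
    x ^ s ≤ 1 + x ^ (2 : ℝ) := by
  rcases le_total x 1 with h | h
  · exact (ENNReal.rpow_le_one h hs).trans le_self_add
  · exact (ENNReal.rpow_le_rpow_of_exponent_le h hs2).trans le_add_self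

namespace IsMatrixWeight

variable {W : (Fin d → ℝ) → Matrix (Fin n) (Fin n) ℝ}

/-- The exponent relation used for Hölder also gives, pointwise, |W^{1/2}ξ|^{1+ε}|f|^{1+ε} ≤
⟨Wξ,ξ⟩^{1+δ} + |f|^s, and both terms are locally integrable. This shows that the chosen ε is
admissible in the infimum. -/
lemma memLpLoc_sqrtMul (hW : IsMatrixWeight W) {f : (Fin d → ℝ) → EuclideanSpace ℝ (Fin n)}
    (hf : MemLp f 2 volume) {ε δ s : ℝ} (hε : 0 < ε) (hδ : 0 < δ) (hs : 0 < s) (hs2 : s ≤ 2)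
    (hsum : ε / (1 + ε) + 1 / (2 * (1 + δ)) + 1 / s = 1)
    (hRH : ∀ ξ : EuclideanSpace ℝ (Fin n), ‖ξ‖ = 1 → ∀ Q : Cube d,
      ∫⁻ x in Q.toSet, ENNReal.ofReal (dirWeight W ξ x) ^ (1 + δ) ≠ ∞) :
    MemLpLoc (sqrtMul W f) (ENNReal.ofReal (1 + ε)) := by
  intro K hK
  obtain ⟨Q, hQ⟩ := Cube.exists_toSet_superset hK.isBounded
  have hm := hW.aestronglyMeasurable_sqrtMul hf.1
  refine MemLp.mono_measure (Measure.restrict_mono hQ le_rfl) (memLp_of_inner hm.restrict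
    fun ξ hξ => ⟨(hm.inner aestronglyMeasurable_const).restrict, ?_⟩)
  have hp : 0 < 1 + ε := by linarith
  rw [eLpNorm_lt_top_iff_lintegral_rpow_enorm_lt_top (by simpa using hp) ENNReal.ofReal_ne_top,
    ENNReal.toReal_ofReal hp.le]
  have hsum' : (1 + ε) * (1 / (2 * (1 + δ))) + (1 + ε) * (1 / s) = 1 := by
    have : 1 / (2 * (1 + δ)) + 1 / s = 1 / (1 + ε) := by
      have h1 : ε / (1 + ε) + 1 / (1 + ε) = 1 := by field_simp; ring
      linarith
    rw [← mul_add, this]; field_simp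
  have h1 : ∀ᵐ x, ‖inner ℝ (sqrtMul W f x) ξ‖ₑ ^ (1 + ε) ≤
      (1 + ‖f x‖ₑ ^ (2 : ℝ)) + ENNReal.ofReal (dirWeight W ξ x) ^ (1 + δ) := by
    filter_upwards [hW.enorm_inner_sqrtMul_le f ξ] with x hx
    set u := ENNReal.ofReal (dirWeight W ξ x)
    calc _ ≤ (u ^ (1 / 2 : ℝ) * ‖f x‖ₑ) ^ (1 + ε) := by gcongr
      _ = (u ^ (1 + δ)) ^ ((1 + ε) * (1 / (2 * (1 + δ)))) *
          (‖f x‖ₑ ^ s) ^ ((1 + ε) * (1 / s)) := by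
        rw [ENNReal.mul_rpow_of_nonneg _ _ hp.le, ← ENNReal.rpow_mul, ← ENNReal.rpow_mul,
          ← ENNReal.rpow_mul]
        congr 2 <;> field_simp
      _ ≤ u ^ (1 + δ) + ‖f x‖ₑ ^ s :=
        rpow_mul_rpow_le_add _ _ (by positivity) (by positivity) hsum'
      _ ≤ _ := by
        rw [add_comm]
        gcongr
        exact rpow_le_one_add_sq _ hs.le hs2
  refine (lintegral_mono_ae (ae_restrict_of_ae h1)).trans_lt ?_
  have hfm : AEMeasurable (fun x => 1 + ‖f x‖ₑ ^ (2 : ℝ)) (volume.restrict Q.toSet) :=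
    aemeasurable_const.add (hf.1.enorm.restrict.pow_const _)
  rw [lintegral_add_left' hfm, lintegral_add_left measurable_const, lintegral_one,
    Measure.restrict_apply_univ]
  refine ENNReal.add_lt_top.2 ⟨ENNReal.add_lt_top.2 ⟨Q.vol_ne_top.lt_top, ?_⟩,
    (hRH ξ hξ Q).lt_top⟩
  have h2 := lintegral_rpow_enorm_lt_top_of_eLpNorm_lt_top (by simp) (by simp) hf.2
  exact (lintegral_mono' Measure.restrict_le_self le_rfl).trans_lt (by simpa using h2)

/-- The estimates for one of the two functions in the sparse form. -/
lemma exists_bound (hW : IsMatrixWeight W) {A : ℝ} (hA : 1 ≤ A)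
    (hWA : matAinfConst W ≤ ENNReal.ofReal A) {ε : ℝ} (hε : 0 < ε)
    (hεA : 6 * ε ≤ 1 / (2 ^ (d + 1) * A)) {f : (Fin d → ℝ) → EuclideanSpace ℝ (Fin n)}
    (hf : MemLp f 2 volume) (hf1 : eLpNorm f 2 volume = 1) :
    MemLpLoc (sqrtMul W f) (ENNReal.ofReal (1 + ε)) ∧
    ∃ X : Cube d → ℝ≥0∞,
      (∀ Q, ∀ a ∈ convexBody (ENNReal.ofReal (1 + ε)) Q (sqrtMul W f),
        ∀ ξ : EuclideanSpace ℝ (Fin n), ‖ξ‖ = 1 →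
        ‖inner ℝ a ξ‖ₑ ≤ 2 * X Q * ‖Matrix.toEuclideanCLM (𝕜 := ℝ) (matSqrt (matAvg W Q)) ξ‖ₑ) ∧
      ∀ S : Set (Cube d), IsSparse (1 / 2) S →
        ∑' Q : S, (Q : Cube d).vol * X Q ^ 2 ≤
          96 * 5 ^ d * 2 ^ (d + 1) * ENNReal.ofReal A := by
  -- The largest δ that the reverse Hölder inequality admits for the bound A.
  set δ : ℝ := 1 / (2 ^ (d + 1) * A) with hδ
  have hA0 : 0 < A := by linarith
  have hδ0 : 0 < δ := by positivity
  have hδ1 : δ ≤ 1 := by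
    rw [hδ, div_le_one (by positivity)]
    exact one_le_mul_of_one_le_of_one_le (one_le_pow₀ (by norm_num)) hA
  obtain ⟨hq1, hq2⟩ := exponent_bounds hε hδ1 hεA
  -- Solves the Hölder relation for s = 2/q, so that |f|^s lies in L^q.
  set q : ℝ := 2 / (1 + ε) - 1 / (1 + δ) with hq
  have hq1' : 1 < q := by linarith
  have hs0 : 0 < 2 / q := by positivity
  have hs2 : 2 / q ≤ 2 := by rw [div_le_iff₀ (by linarith)]; linarith
  have hsum : ε / (1 + ε) + 1 / (2 * (1 + δ)) + 1 / (2 / q) = 1 := by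
    rw [one_div_div, hq]; field_simp; ring
  have hδA : ENNReal.ofReal A * 2 ^ d * ENNReal.ofReal δ ≤ 1 / 2 := by
    rw [show (2 : ℝ≥0∞) = ENNReal.ofReal 2 by simp, ← ENNReal.ofReal_pow (by norm_num),
      ← ENNReal.ofReal_mul hA0.le, ← ENNReal.ofReal_mul (by positivity), ← ENNReal.ofReal_one,
      ← ENNReal.ofReal_div_of_pos (by norm_num)]
    refine ENNReal.ofReal_le_ofReal (le_of_eq ?_)
    rw [hδ, pow_succ]; field_simp
  have hRH : ∀ ξ : EuclideanSpace ℝ (Fin n), ‖ξ‖ = 1 → ∀ Q : Cube d, _ := fun ξ hξ Q =>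
    reverse_holder (hW.locallyIntegrable_dirWeight ξ) (hW.dirWeight_nonneg ξ)
      ((ainfConst_dirWeight_le hξ).trans hWA) hδ0 hδA Q
  refine ⟨hW.memLpLoc_sqrtMul hf hε hδ0 hs0 hs2 hsum fun ξ hξ Q =>
    ne_top_of_le_ne_top ?_ (hRH ξ hξ Q), fun Q => lavg (fun x => ‖f x‖ₑ ^ (2 / q)) Q ^ (1 / (2 / q)),
    fun Q a ha ξ hξ => ?_, fun S hS => ?_⟩
  · rw [hW.lavg_dirWeight]
    exact ENNReal.mul_ne_top (ENNReal.mul_ne_top (by simp) (ENNReal.rpow_ne_top_of_nonneg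
      (by positivity) (ENNReal.pow_ne_top enorm_ne_top))) Q.vol_ne_top
  · refine (hW.enorm_inner_convexBody_le hf.1 hε hδ0 hs0 hsum (hRH ξ hξ Q) ha).trans
      (le_of_eq ?_)
    ring
  · refine (hS.tsum_sq_le hf hq1' hq2).trans ?_
    rw [hf1, one_pow, mul_one]
    have : (ENNReal.ofReal (q - 1))⁻¹ ≤ 6 * (2 ^ (d + 1) * ENNReal.ofReal A) := by
      rw [← ENNReal.ofReal_inv_of_pos (by linarith), show (6 : ℝ≥0∞) = ENNReal.ofReal 6 by simp,
        show (2 : ℝ≥0∞) = ENNReal.ofReal 2 by simp, ← ENNReal.ofReal_pow (by norm_num),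
        ← ENNReal.ofReal_mul (by positivity), ← ENNReal.ofReal_mul (by norm_num)]
      refine ENNReal.ofReal_le_ofReal ?_
      refine (inv_anti₀ (by positivity) hq1).trans (le_of_eq ?_)
      rw [hδ]; field_simp
    calc _ ≤ 16 * 5 ^ d * (6 * (2 ^ (d + 1) * ENNReal.ofReal A)) := by gcongr
      _ = _ := by ring

end IsMatrixWeight

/-! ### Summation over the sparse family -/

lemma enorm_matSqrt_mul_le (W V : (Fin d → ℝ) → Matrix (Fin n) (Fin n) ℝ) (Q : Cube d) :
    ‖Matrix.toEuclideanCLM (𝕜 := ℝ) (matSqrt (matAvg W Q) * matSqrt (matAvg V Q))‖ₑ ≤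
      matA2Const W V ^ (1 / 2 : ℝ) := by
  have h := le_iSup (fun Q : Cube d => ‖Matrix.toEuclideanCLM (𝕜 := ℝ)
    (matSqrt (matAvg W Q) * matSqrt (matAvg V Q))‖ₑ ^ 2) Q
  have h2 := ENNReal.rpow_le_rpow (z := 1 / 2) h (by norm_num)
  rw [← ENNReal.rpow_natCast, ← ENNReal.rpow_mul] at h2
  norm_num at h2
  simpa [matA2Const] using h2

/-- An A_∞ constant below 1 means that all the averages of that weight vanish. The main estimate
assumes bounds at least 1, and this covers the degenerate case. -/
lemma matA2Const_eq_zero {W V : (Fin d → ℝ) → Matrix (Fin n) (Fin n) ℝ} (hW : IsMatrixWeight W)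
    (hV : IsMatrixWeight V) (h : matAinfConst W < 1 ∨ matAinfConst V < 1) :
    matA2Const W V = 0 := by
  refine le_antisymm (iSup_le fun Q => ?_) zero_le
  rw [map_mul]
  rcases h with h | h
  · rw [hW.matSqrt_matAvg_eq_zero h Q, zero_mul, ← ofReal_norm, norm_zero]; simp
  · rw [hV.matSqrt_matAvg_eq_zero h Q, mul_zero, ← ofReal_norm, norm_zero]; simp

/-- The bound for the sparse form with a suitable `ε`, in terms of upper bounds `A`, `B ≥ 1` for
the `A_∞` constants. -/
lemma exists_sparseForm_le {W V : (Fin d → ℝ) → Matrix (Fin n) (Fin n) ℝ} (hW : IsMatrixWeight W)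
    (hV : IsMatrixWeight V) {A B : ℝ} (hA : 1 ≤ A) (hB : 1 ≤ B)
    (hWA : matAinfConst W ≤ ENNReal.ofReal A) (hVB : matAinfConst V ≤ ENNReal.ofReal B)
    {f g : (Fin d → ℝ) → EuclideanSpace ℝ (Fin n)} (hf : MemLp f 2 volume) (hg : MemLp g 2 volume)
    (hf1 : eLpNorm f 2 volume = 1) (hg1 : eLpNorm g 2 volume = 1) {S : Set (Cube d)}
    (hS : IsSparse (1 / 2) S) :
    ∃ ε : ℝ, 0 < ε ∧ MemLpLoc (sqrtMul V f) (ENNReal.ofReal (1 + ε)) ∧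
      MemLpLoc (sqrtMul W g) (ENNReal.ofReal (1 + ε)) ∧
      (ENNReal.ofReal ε)⁻¹ *
          sparseForm (ENNReal.ofReal (1 + ε)) S (sqrtMul V f) (sqrtMul W g) ≤
        (6 * 2 ^ (d + 1) * (4 * n ^ 2) * (96 * 5 ^ d * 2 ^ (d + 1))) *
          ENNReal.ofReal (max A B) *
          (matA2Const W V * ENNReal.ofReal A * ENNReal.ofReal B) ^ (1 / 2 : ℝ) := by
  set m := max A B with hm
  have hm1 : 1 ≤ m := hA.trans (le_max_left _ _)
  -- Makes 6ε the smaller of the two reverse Hölder gains, so that one ε suits both weights.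
  set ε : ℝ := 1 / (6 * (2 ^ (d + 1) * m)) with hε
  have hε0 : 0 < ε := by positivity
  have hbound : ∀ D : ℝ, 1 ≤ D → D ≤ m → 6 * ε ≤ 1 / (2 ^ (d + 1) * D) := by
    intro D hD hDm
    calc 6 * ε = 1 / (2 ^ (d + 1) * m) := by rw [hε]; field_simp
      _ ≤ _ := by gcongr
  obtain ⟨hVf, X, hX, hXs⟩ := hV.exists_bound hB hVB hε0 (hbound B hB (le_max_right _ _)) hf hf1
  obtain ⟨hWg, Y, hY, hYs⟩ := hW.exists_bound hA hWA hε0 (hbound A hA (le_max_left _ _)) hg hg1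
  refine ⟨ε, hε0, hVf, hWg, ?_⟩
  have hterm : ∀ Q : Cube d, Q.vol * bodyProd
      (convexBody (ENNReal.ofReal (1 + ε)) Q (sqrtMul V f))
      (convexBody (ENNReal.ofReal (1 + ε)) Q (sqrtMul W g)) ≤
      4 * n ^ 2 * matA2Const W V ^ (1 / 2 : ℝ) *
        ((Q.vol ^ (1 / 2 : ℝ) * X Q) * (Q.vol ^ (1 / 2 : ℝ) * Y Q)) := by
    intro Q
    have hv : Q.vol ^ (1 / 2 : ℝ) * Q.vol ^ (1 / 2 : ℝ) = Q.vol := by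
      rw [← ENNReal.rpow_add_of_nonneg _ _ (by norm_num) (by norm_num)]
      norm_num
    calc _ ≤ Q.vol * (n ^ 2 * (2 * X Q * (2 * Y Q) * matA2Const W V ^ (1 / 2 : ℝ))) := by
          gcongr
          refine iSup₂_le fun a ha => iSup₂_le fun b hb => ?_
          refine le_trans ?_ ((enorm_inner_le_of_enorm_inner_le (isHermitian_matSqrt (matAvg W Q))
            (isHermitian_matSqrt (matAvg V Q)) (hX Q a ha) (hY Q b hb)).trans ?_)
          · rw [← ofReal_norm]
            exact ENNReal.ofReal_le_ofReal (le_abs_self _)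
          · gcongr
            exact enorm_matSqrt_mul_le W V Q
      _ = 4 * n ^ 2 * matA2Const W V ^ (1 / 2 : ℝ) *
          ((Q.vol ^ (1 / 2 : ℝ) * Q.vol ^ (1 / 2 : ℝ)) * (X Q * Y Q)) := by rw [hv]; ring
      _ = _ := by ring
  have hsq : ∀ (Q : Cube d) (Z : ℝ≥0∞), (Q.vol ^ (1 / 2 : ℝ) * Z) ^ 2 = Q.vol * Z ^ 2 := by
    intro Q Z
    rw [mul_pow, ← ENNReal.rpow_natCast, ← ENNReal.rpow_mul]
    norm_num
  set K : ℝ≥0∞ := 96 * 5 ^ d * 2 ^ (d + 1) with hK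
  have hKK : K ^ (1 / 2 : ℝ) * K ^ (1 / 2 : ℝ) = K := by
    rw [← ENNReal.rpow_add_of_nonneg _ _ (by norm_num) (by norm_num)]
    norm_num
  have hform : sparseForm (ENNReal.ofReal (1 + ε)) S (sqrtMul V f) (sqrtMul W g) ≤
      4 * n ^ 2 * matA2Const W V ^ (1 / 2 : ℝ) * ((K * ENNReal.ofReal B) ^ (1 / 2 : ℝ) *
        (K * ENNReal.ofReal A) ^ (1 / 2 : ℝ)) := by
    refine (ENNReal.tsum_le_tsum fun Q : S => hterm Q).trans ?_
    rw [ENNReal.tsum_mul_left]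
    gcongr 4 * n ^ 2 * matA2Const W V ^ (1 / 2 : ℝ) * ?_
    refine (tsum_mul_le_sqrt_mul_sqrt _ _).trans ?_
    simp only [hsq]
    gcongr
    · exact hXs S hS
    · exact hYs S hS
  have hεinv : (ENNReal.ofReal ε)⁻¹ = 6 * 2 ^ (d + 1) * ENNReal.ofReal m := by
    rw [← ENNReal.ofReal_inv_of_pos hε0, hε, one_div, inv_inv, ENNReal.ofReal_mul (by norm_num),
      ENNReal.ofReal_mul (by positivity), ENNReal.ofReal_pow (by norm_num)]
    simp [mul_assoc]
  rw [hεinv]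
  calc _ ≤ 6 * 2 ^ (d + 1) * ENNReal.ofReal m * (4 * n ^ 2 * matA2Const W V ^ (1 / 2 : ℝ) *
        ((K * ENNReal.ofReal B) ^ (1 / 2 : ℝ) * (K * ENNReal.ofReal A) ^ (1 / 2 : ℝ))) := by gcongr
    _ = 6 * 2 ^ (d + 1) * (4 * n ^ 2) * (K ^ (1 / 2 : ℝ) * K ^ (1 / 2 : ℝ)) * ENNReal.ofReal m *
        (matA2Const W V * ENNReal.ofReal A * ENNReal.ofReal B) ^ (1 / 2 : ℝ) := by
      have h2 : (0 : ℝ) ≤ 1 / 2 := by norm_num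
      rw [ENNReal.mul_rpow_of_nonneg K _ h2, ENNReal.mul_rpow_of_nonneg K _ h2,
        ENNReal.mul_rpow_of_nonneg _ (ENNReal.ofReal B) h2,
        ENNReal.mul_rpow_of_nonneg _ (ENNReal.ofReal A) h2]
      ring
    _ = _ := by rw [hKK]

end MatrixSparse

end

theorem proposition5 (d n : ℕ) (hd : 0 < d) :
    ∃ C : ℝ≥0, ∀ W V : (Fin d → ℝ) → Matrix (Fin n) (Fin n) ℝ,
      MatrixSparse.IsMatrixWeight W → MatrixSparse.IsMatrixWeight V →
      MatrixSparse.matAinfConst W < ∞ → MatrixSparse.matAinfConst V < ∞ →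
      ∀ f g : (Fin d → ℝ) → EuclideanSpace ℝ (Fin n),
      MemLp f 2 volume → MemLp g 2 volume →
      eLpNorm f 2 volume = 1 → eLpNorm g 2 volume = 1 →
      ∀ S : Set (MatrixSparse.Cube d), MatrixSparse.IsSparse (1 / 2) S →
      (⨅ (ε : ℝ) (_ : 0 < ε)
          (_ : MatrixSparse.MemLpLoc (MatrixSparse.sqrtMul V f) (ENNReal.ofReal (1 + ε)))
          (_ : MatrixSparse.MemLpLoc (MatrixSparse.sqrtMul W g) (ENNReal.ofReal (1 + ε))),
        (ENNReal.ofReal ε)⁻¹ *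
          MatrixSparse.sparseForm (ENNReal.ofReal (1 + ε)) S
            (MatrixSparse.sqrtMul V f) (MatrixSparse.sqrtMul W g))
        ≤ C * max (MatrixSparse.matAinfConst W) (MatrixSparse.matAinfConst V) *
          (MatrixSparse.matA2Const W V * MatrixSparse.matAinfConst W *
            MatrixSparse.matAinfConst V) ^ (1 / 2 : ℝ) := by
  -- The factors come from 1/ε, from the product of two convex bodies, and from the geometric mean
  -- of the two Carleson sums.
  refine ⟨6 * 2 ^ (d + 1) * (4 * n ^ 2) * (96 * 5 ^ d * 2 ^ (d + 1)), ?_⟩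
  intro W V hW hV hWt hVt f g hf hg hf1 hg1 S hS
  set A := MatrixSparse.matAinfConst W with hA
  set B := MatrixSparse.matAinfConst V with hB
  have hle : ∀ D : ℝ≥0∞, D < ∞ → D ≤ ENNReal.ofReal (max D.toReal 1) := fun D hD => by
    rw [← ENNReal.ofReal_toReal hD.ne]
    refine ENNReal.ofReal_le_ofReal ?_
    rw [ENNReal.toReal_ofReal ENNReal.toReal_nonneg]
    exact le_max_left _ _
  -- The constants are raised to at least 1. This changes nothing unless one of them is below 1, and
  -- then the A_2 constant is zero and the bound just obtained vanishes.
  obtain ⟨ε, hε, h1, h2, h3⟩ := MatrixSparse.exists_sparseForm_le hW hV (le_max_right A.toReal 1)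
    (le_max_right B.toReal 1) (hle A hWt) (hle B hVt) hf hg hf1 hg1 hS
  refine (iInf₂_le_of_le ε hε (iInf₂_le_of_le h1 h2 h3)).trans ?_
  rcases lt_or_ge A 1 with hA1 | hA1
  · rw [MatrixSparse.matA2Const_eq_zero hW hV (Or.inl hA1)]; simp
  rcases lt_or_ge B 1 with hB1 | hB1
  · rw [MatrixSparse.matA2Const_eq_zero hW hV (Or.inr hB1)]; simp
  have heq : ∀ D : ℝ≥0∞, D < ∞ → 1 ≤ D → ENNReal.ofReal (max D.toReal 1) = D := fun D hD h => by
    rw [max_eq_left ((ENNReal.toReal_mono hD.ne h).trans' (by simp)), ENNReal.ofReal_toReal hD.ne]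
  rw [ENNReal.ofReal_max, heq A hWt hA1, heq B hVt hB1]
  push_cast
  exact le_rfl
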